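/- Let $K$ be an algebraic number field with ring of integers $\mathcal O$, unit group $\mathcal O^*$, and $\mathcal O^\times=\mathcal O\setminus\{0\}$. Let $P_K$ be the group of matrices $\begin{pmatrix}1&y\\0&x\end{pmatrix}$ with $y\in K$, $x\in K^*$, and $P_{\mathcal O}\subset P_K$ the subgroup of those with $y\in\mathcal O$, $x\in\mathcal O^*$; this is a Hecke pair, i.e. every double coset of $P_{\mathcal O}$ contains finitely many right cosets $P_{\mathcal O}\gamma$. Let $\mathcal H=\mathcal H(P_K,P_{\mathcal O})$ be the unital *-algebra of complex $P_{\mathcal O}$-bi-invariant functions on $P_K$ supported on finitely many double cosets, with product $(f*g)(\gamma)=\sum_{\gamma_1\in P_{\mathcal O}\backslash P_K}f(\gamma\gamma_1^{-1})g(\gamma_1)$ and involution $f^*(\gamma)=\overline{f(\gamma^{-1})}$. Let $\lambda(f)\xi=f*\xi$ be the Hecke representation of $\mathcal H$ on $\ell^2(P_{\mathcal O}\backslash P_K)$, and let the Hecke C*-algebra $C^*_r(P_K,P_{\mathcal O})$ be the norm closure of $\lambda(\mathcal H)$. The group $\mathcal O^*$ acts on $K/\mathcal O$ by multiplication; let $\mathcal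 O^*_r$ be the stabilizer of $r\in K/\mathcal O$, which has finite index. For $r\in K/\mathcal O$ let $R(r)$ be the number of right cosets in the double coset $P_{\mathcal O}\begin{pmatrix}1&r\\0&1\end{pmatrix}P_{\mathcal O}$ (which depends only on the class of $r$ modulo $\mathcal O$) and let $\theta_r\in\mathcal H$ be $R(r)^{-1}$ times the characteristic function of this double coset. Let $\mathfrak A$ be the *-subalgebra of $\mathcal H$ generated by all $\theta_r$, $r\in K/\mathcal O$. Consider, for a family $(x_r)_{r\in K/\mathcal O}$ in a unital *-algebra over $\mathbb C$, the relations $$\text{(II)}\qquad x_0=1,\qquad x_{wr}=x_r=x_r^*,\qquad x_rx_s=\frac1{R(r)}\frac1{R(s)}\sum_{u\in\mathcal O^*/\mathcal O^*_r}\ \sum_{v\in\mathcal O^*/\mathcal O^*_s}x_{ur+vs}\qquad(r,s\in K/\mathcal O,\ w\in\mathcal O^*).$$ (1) The $\theta_r$ satisfy (II), and $\mathfrak A$ is universal for (II): for every unital *-algebra $B$ over $\mathbb C$ and every family $(x_r)$ in $B$ satisfying (II) there is a unique unital *-homomorphism $\mathfrak A\to B$ with $\theta_r\mapsto x_r$ for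 all $r$. Moreover $\theta_r$ depends only on the $\mathcal O^*$-orbit of $r$, the $\theta_r$, indexed by the $\mathcal O^*$-orbits in $K/\mathcal O$, form a linear basis of $\mathfrak A$, and $\mathfrak A$ is commutative. (2) For each $d\in\mathcal O^\times$ the linear span $\mathfrak A(d)$ of $\{\theta_r : r\in K,\ rd\in\mathcal O\}$ is a finite-dimensional unital *-subalgebra, and $\mathfrak A=\bigcup_{d\in\mathcal O^\times}\mathfrak A(d)$. (3) $\lambda$ is injective on $\mathfrak A$. Let $A_\theta\subset C^*_r(P_K,P_{\mathcal O})$ be the C*-subalgebra generated by $\lambda(\mathfrak A)$. The $\lambda(\theta_r)$ satisfy (II), and $A_\theta$ is universal for (II) among unital C*-algebras: for every unital C*-algebra $B$ and every family $(x_r)$ in $B$ satisfying (II) there is a unique unital *-homomorphism $A_\theta\to B$ with $\lambda(\theta_r)\mapsto x_r$ for all $r$. (4) Let $\vartheta_r=\frac1{R(r)}\sum_{u\in\mathcal O^*/\mathcal O^*_r}\delta_{ur}\in\mathbb C[K/\mathcal O]$. There is a unique unital *-homomorphism $\mathfrak A\to\mathbb C[K/\mathcal O]$ with $\theta_r\mapsto\vartheta_r$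 for all $r$, and it is injective. There is a unique unital *-homomorphism from $A_\theta$ to the group C*-algebra $C^*(K/\mathcal O)$ (the completion of $\mathbb C[K/\mathcal O]$ in its greatest C*-seminorm) with $\lambda(\theta_r)\mapsto\vartheta_r$ for all $r$, and it is injective and isometric. -/

import Mathlib

open scoped NumberField ComplexConjugate

universe u v w

/-! ### Hecke pairs and Hecke algebras -/

section Hecke

variable {G : Type u} [Group G] (Γ : Subgroup G)

/-- The space `Γ \ G` of right cosets `Γ g`. -/
abbrev RightCosets : Type u := Quotient (QuotientGroup.rightRel Γ)

/-- The right coset `Γ g` as a point of `Γ \ G`. -/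
abbrev mkRightCoset (g : G) : RightCosets Γ := Quotient.mk (QuotientGroup.rightRel Γ) g

/-- The set of right cosets contained in the double coset `Γ g Γ`. -/
def rightCosetsIn (g : G) : Set (RightCosets Γ) :=
  mkRightCoset Γ '' DoubleCoset.doubleCoset g (Γ : Set G) (Γ : Set G)

/-- `R(g)`, the number of right cosets in the double coset `Γ g Γ`. -/
noncomputable def numRightCosets (g : G) : ℕ := (rightCosetsIn Γ g).ncard

/-- `(G, Γ)` is a Hecke pair: every double coset contains finitely many right cosets. -/
class IsHeckePair : Prop where
  finite_rightCosetsIn : ∀ g : G, (rightCosetsIn Γ g).Finite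

/-- The convolution product
`(f * ξ)(γ) = ∑_{γ₁ ∈ Γ \ G} f(γ γ₁⁻¹) ξ(γ₁)`.  In all uses `f` is right invariant and `ξ` is left
invariant under `Γ`, so that the summand depends only on the coset `Γ γ₁`, and the sum is finite. -/
noncomputable def heckeConv (f ξ : G → ℂ) (γ : G) : ℂ :=
  ∑ᶠ q : RightCosets Γ, f (γ * q.out⁻¹) * ξ q.out

/-- Complex functions on `G` which are bi-invariant under `Γ` and supported on finitely many double
cosets. -/
structure IsHeckeFun (f : G → ℂ) : Prop where
  left_inv : ∀ h ∈ Γ, ∀ g, f (h * g) = f g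
  right_inv : ∀ h ∈ Γ, ∀ g, f (g * h) = f g
  finite_supp : ∃ s : Finset G, ∀ g, f g ≠ 0 →
    ∃ a ∈ s, g ∈ DoubleCoset.doubleCoset a (Γ : Set G) (Γ : Set G)

variable {Γ}

theorem mkRightCoset_eq_iff {a b : G} : mkRightCoset Γ a = mkRightCoset Γ b ↔ b * a⁻¹ ∈ Γ := by
  rw [Quotient.eq]
  exact QuotientGroup.rightRel_apply

theorem out_mkRightCoset {M : Type*} {F : G → M} (hF : ∀ h ∈ Γ, ∀ g, F (h * g) = F g) (g : G) :
    F (mkRightCoset Γ g).out = F g := by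
  have h : mkRightCoset Γ (mkRightCoset Γ g).out = mkRightCoset Γ g := Quotient.out_eq _
  rw [mkRightCoset_eq_iff] at h
  have := hF _ h (mkRightCoset Γ g).out
  rw [← this]
  simp

variable (Γ) in
/-- Right translation on right cosets. -/
def rightTranslate (g : G) : RightCosets Γ ≃ RightCosets Γ where
  toFun := Quotient.map (· * g) (by
    intro a b hab
    have := QuotientGroup.rightRel_apply.1 hab
    exact QuotientGroup.rightRel_apply.2 (by simpa [mul_assoc] using this))
  invFun := Quotient.map (· * g⁻¹) (by
    intro a b hab
    have := QuotientGroup.rightRel_apply.1 hab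
    exact QuotientGroup.rightRel_apply.2 (by simpa [mul_assoc] using this))
  left_inv q := by
    induction q using Quotient.inductionOn
    simp
  right_inv q := by
    induction q using Quotient.inductionOn
    simp

theorem rightTranslate_eq (g : G) (q : RightCosets Γ) :
    rightTranslate Γ g q = mkRightCoset Γ (q.out * g) := by
  conv_lhs => rw [← Quotient.out_eq q]
  rfl

theorem out_rightTranslate {M : Type*} {F : G → M} (hF : ∀ h ∈ Γ, ∀ g, F (h * g) = F g) (g : G)
    (q : RightCosets Γ) : F (rightTranslate Γ g q).out = F (q.out * g) := by
  rw [rightTranslate_eq, out_mkRightCoset hF]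

theorem finsum_translate {M : Type*} [AddCommMonoid M] {F : G → M}
    (hF : ∀ h ∈ Γ, ∀ g, F (h * g) = F g) (g : G) :
    ∑ᶠ q : RightCosets Γ, F (q.out * g) = ∑ᶠ q : RightCosets Γ, F q.out := by
  rw [← finsum_comp_equiv (rightTranslate Γ g) (f := fun q => F q.out)]
  exact finsum_congr fun q => (out_rightTranslate hF g q).symm

theorem finite_translate {F : G → ℂ}
    (hF : ∀ h ∈ Γ, ∀ g, F (h * g) = F g) (hfin : {q : RightCosets Γ | F q.out ≠ 0}.Finite) (g : G) :
    {q : RightCosets Γ | F (q.out * g) ≠ 0}.Finite := by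
  have := hfin.preimage (f := rightTranslate Γ g) (rightTranslate Γ g).injective.injOn
  refine this.subset fun q hq => ?_
  simpa [out_rightTranslate hF] using hq

theorem IsHeckeFun.finite [IsHeckePair Γ] {f : G → ℂ} (hf : IsHeckeFun Γ f) :
    {q : RightCosets Γ | f q.out ≠ 0}.Finite := by
  obtain ⟨s, hs⟩ := hf.finite_supp
  refine (s.finite_toSet.biUnion fun a _ => IsHeckePair.finite_rightCosetsIn (Γ := Γ) a).subset ?_
  intro q hq
  obtain ⟨a, ha, hm⟩ := hs _ hq
  exact Set.mem_biUnion ha ⟨q.out, hm, Quotient.out_eq q⟩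

theorem IsHeckeFun.of_finite {f : G → ℂ} (hl : ∀ h ∈ Γ, ∀ g, f (h * g) = f g)
    (hr : ∀ h ∈ Γ, ∀ g, f (g * h) = f g) {s : Set G} (hs : s.Finite)
    (h : ∀ g, f g ≠ 0 → ∃ a ∈ s, g * a⁻¹ ∈ Γ) : IsHeckeFun Γ f := by
  refine ⟨hl, hr, hs.toFinset, fun g hg => ?_⟩
  obtain ⟨a, ha, hm⟩ := h g hg
  exact ⟨a, hs.mem_toFinset.2 ha, DoubleCoset.mem_doubleCoset.2 ⟨_, hm, 1, Γ.one_mem, by simp⟩⟩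

theorem IsHeckeFun.conjInv {f : G → ℂ} (hf : IsHeckeFun Γ f) :
    IsHeckeFun Γ fun g => conj (f g⁻¹) := by
  refine ⟨fun h hh g => ?_, fun h hh g => ?_, ?_⟩
  · simp only [mul_inv_rev]
    rw [hf.right_inv _ (Γ.inv_mem hh)]
  · simp only [mul_inv_rev]
    rw [hf.left_inv _ (Γ.inv_mem hh)]
  · classical
    obtain ⟨s, hs⟩ := hf.finite_supp
    refine ⟨s.image (·⁻¹), fun g hg => ?_⟩
    obtain ⟨a, ha, hm⟩ := hs g⁻¹ (by simpa using hg)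
    refine ⟨a⁻¹, Finset.mem_image_of_mem _ ha, ?_⟩
    obtain ⟨x, hx, y, hy, e⟩ := DoubleCoset.mem_doubleCoset.1 hm
    refine DoubleCoset.mem_doubleCoset.2 ⟨y⁻¹, Γ.inv_mem hy, x⁻¹, Γ.inv_mem hx, ?_⟩
    rw [← inv_inv g, e]
    simp [mul_assoc]

theorem IsHeckeFun.finite_row [IsHeckePair Γ] {f : G → ℂ} (hf : IsHeckeFun Γ f) (γ : G) :
    {q : RightCosets Γ | f (γ * q.out⁻¹) ≠ 0}.Finite := by
  refine (finite_translate (F := fun g => conj (f g⁻¹)) hf.conjInv.left_inv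
    hf.conjInv.finite γ⁻¹).subset fun q hq => ?_
  simpa using hq

theorem IsHeckeFun.finite_col [IsHeckePair Γ] {f : G → ℂ} (hf : IsHeckeFun Γ f) (γ : G) :
    {q : RightCosets Γ | f (q.out * γ) ≠ 0}.Finite :=
  finite_translate hf.left_inv hf.finite γ

theorem IsHeckeFun.finite_supp_mul [IsHeckePair Γ] {f : G → ℂ} (hf : IsHeckeFun Γ f) (ξ : G → ℂ)
    (γ : G) : (Function.support fun q : RightCosets Γ => f (γ * q.out⁻¹) * ξ q.out).Finite :=
  (hf.finite_row γ).subset fun _ hq => left_ne_zero_of_mul hq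

theorem heckeConv_left_inv {f ξ : G → ℂ} (hf : ∀ h ∈ Γ, ∀ g, f (h * g) = f g) :
    ∀ h ∈ Γ, ∀ g, heckeConv Γ f ξ (h * g) = heckeConv Γ f ξ g := by
  intro h hh g
  unfold heckeConv
  refine finsum_congr fun q => ?_
  rw [mul_assoc, hf h hh]

theorem heckeConv_summand_inv {f ξ : G → ℂ} (hf : ∀ h ∈ Γ, ∀ g, f (g * h) = f g)
    (hξ : ∀ h ∈ Γ, ∀ g, ξ (h * g) = ξ g) (γ : G) :
    ∀ h ∈ Γ, ∀ g, f (γ * (h * g)⁻¹) * ξ (h * g) = f (γ * g⁻¹) * ξ g := by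
  intro h hh g
  rw [hξ h hh, mul_inv_rev, ← mul_assoc, hf _ (Γ.inv_mem hh)]

theorem heckeConv_translate {f ξ : G → ℂ} (hf : ∀ h ∈ Γ, ∀ g, f (g * h) = f g)
    (hξ : ∀ h ∈ Γ, ∀ g, ξ (h * g) = ξ g) (γ t : G) :
    heckeConv Γ f ξ (γ * t) = ∑ᶠ q : RightCosets Γ, f (γ * q.out⁻¹) * ξ (q.out * t) := by
  have := finsum_translate (F := fun g => f (γ * t * g⁻¹) * ξ g)
    (heckeConv_summand_inv hf hξ (γ * t)) t
  unfold heckeConv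
  rw [← this]
  refine finsum_congr fun q => ?_
  simp [mul_assoc]

theorem heckeConv_assoc [IsHeckePair Γ] {f g ξ : G → ℂ} (hf : IsHeckeFun Γ f)
    (hg : IsHeckeFun Γ g) :
    heckeConv Γ (heckeConv Γ f g) ξ = heckeConv Γ f (heckeConv Γ g ξ) := by
  funext γ
  have h1 : ∀ q : RightCosets Γ, heckeConv Γ f g (γ * q.out⁻¹) * ξ q.out
      = ∑ᶠ p : RightCosets Γ, f (γ * p.out⁻¹) * (g (p.out * q.out⁻¹) * ξ q.out) := by
    intro q
    rw [heckeConv_translate hf.right_inv hg.left_inv, finsum_mul']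
    · exact finsum_congr fun p => mul_assoc _ _ _
    · exact (hf.finite_row γ).subset fun _ hp => left_ne_zero_of_mul hp
  have h2 : ∀ p : RightCosets Γ, f (γ * p.out⁻¹) * heckeConv Γ g ξ p.out
      = ∑ᶠ q : RightCosets Γ, f (γ * p.out⁻¹) * (g (p.out * q.out⁻¹) * ξ q.out) := by
    intro p
    unfold heckeConv
    rw [mul_finsum']
    exact hg.finite_supp_mul ξ p.out
  have e1 : heckeConv Γ (heckeConv Γ f g) ξ γ = ∑ᶠ q : RightCosets Γ, ∑ᶠ p : RightCosets Γ,
      f (γ * p.out⁻¹) * (g (p.out * q.out⁻¹) * ξ q.out) := finsum_congr h1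
  have e2 : heckeConv Γ f (heckeConv Γ g ξ) γ = ∑ᶠ p : RightCosets Γ, ∑ᶠ q : RightCosets Γ,
      f (γ * p.out⁻¹) * (g (p.out * q.out⁻¹) * ξ q.out) := finsum_congr h2
  rw [e1, e2]
  set P := (hf.finite_row γ).toFinset
  have hP : ∀ q : RightCosets Γ, ∑ᶠ p : RightCosets Γ,
      f (γ * p.out⁻¹) * (g (p.out * q.out⁻¹) * ξ q.out)
      = ∑ p ∈ P, f (γ * p.out⁻¹) * (g (p.out * q.out⁻¹) * ξ q.out) := by
    intro q
    refine finsum_eq_sum_of_support_subset _ fun p hp => ?_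
    simpa [P] using left_ne_zero_of_mul hp
  rw [finsum_congr hP, finsum_sum_comm]
  · refine (finsum_eq_sum_of_support_subset _ fun p hp => ?_).symm
    have : f (γ * p.out⁻¹) ≠ 0 := by
      intro h0
      apply hp
      simp [h0]
    simpa [P] using this
  · intro p _
    exact (hg.finite_supp_mul ξ p.out).subset fun q hq => right_ne_zero_of_mul hq

theorem IsHeckeFun.conv [IsHeckePair Γ] {f g : G → ℂ} (hf : IsHeckeFun Γ f)
    (hg : IsHeckeFun Γ g) : IsHeckeFun Γ (heckeConv Γ f g) := by
  refine IsHeckeFun.of_finite (heckeConv_left_inv hf.left_inv) (fun h hh γ => ?_)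
    (hf.finite.image2 (fun p q => p.out * q.out) hg.finite) fun γ hγ => ?_
  · rw [heckeConv_translate hf.right_inv hg.left_inv]
    exact finsum_congr fun q => by rw [hg.right_inv h hh]
  · have : ∃ q : RightCosets Γ, f (γ * q.out⁻¹) * g q.out ≠ 0 := by
      by_contra! h0
      apply hγ
      simp [heckeConv, h0]
    obtain ⟨q, hq⟩ := this
    have hfq := left_ne_zero_of_mul hq
    have hgq := right_ne_zero_of_mul hq
    refine ⟨_, ⟨mkRightCoset Γ (γ * q.out⁻¹), ?_, q, hgq, rfl⟩, ?_⟩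
    · show f _ ≠ 0
      rwa [out_mkRightCoset hf.left_inv]
    · have h : mkRightCoset Γ (mkRightCoset Γ (γ * q.out⁻¹)).out = mkRightCoset Γ (γ * q.out⁻¹) :=
        Quotient.out_eq _
      rw [mkRightCoset_eq_iff] at h
      simpa [mul_assoc] using h

variable (Γ)

/-- The vector space of `Γ`-bi-invariant functions supported on finitely many double cosets. -/
def heckeSubmodule : Submodule ℂ (G → ℂ) where
  carrier := {f | IsHeckeFun Γ f}
  zero_mem' := ⟨by simp, by simp, ∅, by simp⟩
  add_mem' := by
    classical
    rintro f g hf hg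
    obtain ⟨s, hs⟩ := hf.finite_supp
    obtain ⟨t, ht⟩ := hg.finite_supp
    refine ⟨fun h hh x => ?_, fun h hh x => ?_, s ∪ t, fun x hx => ?_⟩
    · simp [hf.left_inv h hh, hg.left_inv h hh]
    · simp [hf.right_inv h hh, hg.right_inv h hh]
    · by_cases h0 : f x = 0
      · obtain ⟨a, ha, h⟩ := ht x (by simpa [h0] using hx)
        exact ⟨a, Finset.mem_union_right _ ha, h⟩
      · obtain ⟨a, ha, h⟩ := hs x h0
        exact ⟨a, Finset.mem_union_left _ ha, h⟩
  smul_mem' := by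
    rintro c f hf
    obtain ⟨s, hs⟩ := hf.finite_supp
    refine ⟨fun h hh x => ?_, fun h hh x => ?_, s, fun x hx => hs x ?_⟩
    · simp [hf.left_inv h hh]
    · simp [hf.right_inv h hh]
    · exact right_ne_zero_of_mul hx

/-- The Hecke algebra `H(G, Γ)`. -/
def HeckeAlgebra : Type u := heckeSubmodule Γ

namespace HeckeAlgebra

noncomputable instance : AddCommGroup (HeckeAlgebra Γ) :=
  inferInstanceAs (AddCommGroup (heckeSubmodule Γ))

noncomputable instance : Module ℂ (HeckeAlgebra Γ) :=
  inferInstanceAs (Module ℂ (heckeSubmodule Γ))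

instance : CoeFun (HeckeAlgebra Γ) fun _ => G → ℂ := ⟨fun f => f.1⟩

variable {Γ}

theorem isHeckeFun (f : HeckeAlgebra Γ) : IsHeckeFun Γ f := f.2

@[ext]
theorem ext {f g : HeckeAlgebra Γ} (h : ∀ x, f x = g x) : f = g := Subtype.ext (funext h)

@[simp] theorem add_apply (f g : HeckeAlgebra Γ) (x : G) : (f + g) x = f x + g x := rfl
@[simp] theorem zero_apply (x : G) : (0 : HeckeAlgebra Γ) x = 0 := rfl
@[simp] theorem smul_apply (c : ℂ) (f : HeckeAlgebra Γ) (x : G) : (c • f) x = c * f x := rfl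

variable (Γ) in
open Classical in
/-- The characteristic function `[Γ a Γ]` of a double coset. -/
noncomputable def char (a : G) : HeckeAlgebra Γ :=
  ⟨fun g => if g ∈ DoubleCoset.doubleCoset a (Γ : Set G) (Γ : Set G) then 1 else 0, by
    have key : ∀ h ∈ Γ, ∀ k ∈ Γ, ∀ g,
        g ∈ DoubleCoset.doubleCoset a (Γ : Set G) (Γ : Set G) →
        h * g * k ∈ DoubleCoset.doubleCoset a (Γ : Set G) (Γ : Set G) := by
      intro h hh k hk g hg
      obtain ⟨x, hx, y, hy, rfl⟩ := DoubleCoset.mem_doubleCoset.1 hg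
      exact DoubleCoset.mem_doubleCoset.2
        ⟨h * x, Γ.mul_mem hh hx, y * k, Γ.mul_mem hy hk, by simp [mul_assoc]⟩
    refine ⟨fun h hh g => ?_, fun h hh g => ?_, {a}, fun g hg => ⟨a, by simp, ?_⟩⟩
    · refine if_congr ⟨fun H => ?_, fun H => ?_⟩ rfl rfl
      · simpa using key h⁻¹ (Γ.inv_mem hh) 1 Γ.one_mem _ H
      · simpa using key h hh 1 Γ.one_mem _ H
    · refine if_congr ⟨fun H => ?_, fun H => ?_⟩ rfl rfl
      · simpa using key 1 Γ.one_mem h⁻¹ (Γ.inv_mem hh) _ H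
      · simpa using key 1 Γ.one_mem h hh _ H
    · by_contra h0
      simp [h0] at hg⟩

open Classical in
theorem char_one_apply (g : G) : char Γ 1 g = if g ∈ Γ then 1 else 0 := by
  refine if_congr ⟨fun H => ?_, fun H => ?_⟩ rfl rfl
  · obtain ⟨x, hx, y, hy, rfl⟩ := DoubleCoset.mem_doubleCoset.1 H
    simpa using Γ.mul_mem hx hy
  · exact DoubleCoset.mem_doubleCoset.2 ⟨g, H, 1, Γ.one_mem, by simp⟩

theorem one_conv {ξ : G → ℂ} (hξ : ∀ h ∈ Γ, ∀ g, ξ (h * g) = ξ g) :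
    heckeConv Γ (char Γ 1) ξ = ξ := by
  classical
  funext γ
  unfold heckeConv
  rw [finsum_eq_single _ (mkRightCoset Γ γ)]
  · rw [char_one_apply, if_pos, one_mul, out_mkRightCoset hξ]
    exact mkRightCoset_eq_iff.1 (Quotient.out_eq (mkRightCoset Γ γ))
  · intro q hq
    rw [char_one_apply, if_neg, zero_mul]
    intro h
    apply hq
    rw [← Quotient.out_eq q]
    exact mkRightCoset_eq_iff.2 h

theorem conv_one {f : G → ℂ} (hf : ∀ h ∈ Γ, ∀ g, f (g * h) = f g) :
    heckeConv Γ f (char Γ 1) = f := by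
  classical
  funext γ
  unfold heckeConv
  have h1 : mkRightCoset Γ (mkRightCoset Γ (1 : G)).out = mkRightCoset Γ 1 := Quotient.out_eq _
  rw [mkRightCoset_eq_iff, one_mul] at h1
  rw [finsum_eq_single _ (mkRightCoset Γ 1)]
  · rw [char_one_apply, if_pos, mul_one, hf _ h1]
    simpa using Γ.inv_mem h1
  · intro q hq
    rw [char_one_apply, if_neg, mul_zero]
    intro h
    apply hq
    rw [← Quotient.out_eq q]
    exact mkRightCoset_eq_iff.2 (by simpa using h)

/-- The involution `f^*(γ) = conj (f(γ⁻¹))`. -/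
noncomputable instance : Star (HeckeAlgebra Γ) :=
  ⟨fun f => ⟨fun g => conj (f g⁻¹), f.isHeckeFun.conjInv⟩⟩

theorem star_apply (f : HeckeAlgebra Γ) (x : G) : (star f) x = conj (f x⁻¹) := rfl

variable [IsHeckePair Γ]

noncomputable instance : Mul (HeckeAlgebra Γ) :=
  ⟨fun f g => ⟨heckeConv Γ f g, f.isHeckeFun.conv g.isHeckeFun⟩⟩

noncomputable instance : One (HeckeAlgebra Γ) := ⟨char Γ 1⟩

theorem mul_apply (f g : HeckeAlgebra Γ) (x : G) : (f * g) x = heckeConv Γ f g x := rfl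
theorem mul_coe (f g : HeckeAlgebra Γ) : ((f * g : HeckeAlgebra Γ) : G → ℂ) = heckeConv Γ f g := rfl

theorem add_conv (f g : HeckeAlgebra Γ) (ξ : G → ℂ) (x : G) :
    heckeConv Γ (f + g : HeckeAlgebra Γ) ξ x = heckeConv Γ f ξ x + heckeConv Γ g ξ x := by
  unfold heckeConv
  rw [← finsum_add_distrib (f.isHeckeFun.finite_supp_mul ξ x) (g.isHeckeFun.finite_supp_mul ξ x)]
  exact finsum_congr fun q => by rw [add_apply, add_mul]

theorem conv_add (f : HeckeAlgebra Γ) (ξ η : G → ℂ) (x : G) :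
    heckeConv Γ f (ξ + η) x = heckeConv Γ f ξ x + heckeConv Γ f η x := by
  unfold heckeConv
  rw [← finsum_add_distrib (f.isHeckeFun.finite_supp_mul ξ x) (f.isHeckeFun.finite_supp_mul η x)]
  exact finsum_congr fun q => by rw [Pi.add_apply, mul_add]

theorem smul_conv (c : ℂ) (f : HeckeAlgebra Γ) (ξ : G → ℂ) (x : G) :
    heckeConv Γ (c • f : HeckeAlgebra Γ) ξ x = c * heckeConv Γ f ξ x := by
  unfold heckeConv
  rw [mul_finsum' _ _ (f.isHeckeFun.finite_supp_mul ξ x)]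
  exact finsum_congr fun q => by rw [smul_apply, mul_assoc]

theorem conv_smul (c : ℂ) (f : HeckeAlgebra Γ) (ξ : G → ℂ) (x : G) :
    heckeConv Γ f (c • ξ) x = c * heckeConv Γ f ξ x := by
  unfold heckeConv
  rw [mul_finsum' _ _ (f.isHeckeFun.finite_supp_mul ξ x)]
  exact finsum_congr fun q => by rw [Pi.smul_apply, smul_eq_mul, mul_left_comm]

/-- The convolution algebra structure on `H(G, Γ)`; the unit is the characteristic function
of `Γ`. -/
noncomputable instance : Ring (HeckeAlgebra Γ) where
  __ := (inferInstance : AddCommGroup (HeckeAlgebra Γ))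
  left_distrib f g h := ext fun x => conv_add f g h x
  right_distrib f g h := ext fun x => add_conv f g h x
  zero_mul f := ext fun x => by
    simp [mul_apply, heckeConv]
  mul_zero f := ext fun x => by
    rw [mul_apply]
    simp [heckeConv]
  mul_assoc f g h :=
    Subtype.ext (heckeConv_assoc f.isHeckeFun g.isHeckeFun)
  one_mul f := Subtype.ext (one_conv f.isHeckeFun.left_inv)
  mul_one f := Subtype.ext (conv_one f.isHeckeFun.right_inv)

noncomputable instance : Algebra ℂ (HeckeAlgebra Γ) :=
  Algebra.ofModule (fun c f g => ext fun x => smul_conv c f g x)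
    (fun c f g => ext fun x => conv_smul c f g x)

noncomputable instance : StarRing (HeckeAlgebra Γ) where
  star_involutive f := ext fun x => by simp [star_apply]
  star_add f g := ext fun x => by simp [star_apply]
  star_mul f g := ext fun x => by
    rw [star_apply, mul_apply, mul_apply]
    have h := heckeConv_translate f.isHeckeFun.right_inv g.isHeckeFun.left_inv 1 x⁻¹
    rw [one_mul] at h
    rw [h]
    unfold heckeConv
    have hc : ∀ z : RightCosets Γ → ℂ, conj (∑ᶠ q, z q) = ∑ᶠ q, conj (z q) := by
      intro z
      exact (starRingAut (R := ℂ)).toAddEquiv.map_finsum z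
    rw [hc]
    refine finsum_congr fun q => ?_
    simp [star_apply, mul_comm]

instance : StarModule ℂ (HeckeAlgebra Γ) where
  star_smul c f := ext fun x => by simp [star_apply]

end HeckeAlgebra

end Hecke

/-! ### The Hecke representation and the Hecke C*-algebra -/

section HeckeRep

variable {G : Type u} [Group G] (Γ : Subgroup G)

/-- The Hilbert space `ℓ²(Γ \ G)`. -/
abbrev HeckeL2 : Type u := lp (fun _ : RightCosets Γ => ℂ) 2

variable {Γ}

/-- A function on `Γ \ G` viewed as a left `Γ`-invariant function on `G`. -/
def pullback (ξ : RightCosets Γ → ℂ) (g : G) : ℂ := ξ (mkRightCoset Γ g)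

theorem pullback_left_inv (ξ : RightCosets Γ → ℂ) :
    ∀ h ∈ Γ, ∀ g, pullback ξ (h * g) = pullback ξ g := by
  intro h hh g
  unfold pullback
  congr 1
  rw [mkRightCoset_eq_iff]
  simpa using Γ.inv_mem hh

theorem pullback_out (ξ : RightCosets Γ → ℂ) (q : RightCosets Γ) : pullback ξ q.out = ξ q :=
  congrArg ξ (Quotient.out_eq q)

variable [IsHeckePair Γ]

theorem hecke_schur (f : HeckeAlgebra Γ) : ∃ C : ℝ, 0 ≤ C ∧ ∀ (ξ : HeckeL2 Γ)
    (Q : Finset (RightCosets Γ)),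
    ∑ q ∈ Q, ‖heckeConv Γ f (pullback ξ) q.out‖ ^ 2 ≤ C ^ 2 * ‖ξ‖ ^ 2 := by
  classical
  set A : ℝ := ∑ᶠ p : RightCosets Γ, ‖f (p.out)⁻¹‖ with hA
  set B : ℝ := ∑ᶠ q : RightCosets Γ, ‖f q.out‖ with hB
  have hA0 : 0 ≤ A := finsum_nonneg fun _ => norm_nonneg _
  have hB0 : 0 ≤ B := finsum_nonneg fun _ => norm_nonneg _
  have rowSum : ∀ γ : G, ∑ᶠ p : RightCosets Γ, ‖f (γ * p.out⁻¹)‖ = A := by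
    intro γ
    have := finsum_translate (Γ := Γ) (F := fun g => ‖f g⁻¹‖)
      (fun h hh g => by
        simp only [mul_inv_rev]
        rw [f.isHeckeFun.right_inv _ (Γ.inv_mem hh)]) γ⁻¹
    simpa using this
  have colSum : ∀ γ : G, ∑ᶠ q : RightCosets Γ, ‖f (q.out * γ)‖ = B := by
    intro γ
    exact finsum_translate (Γ := Γ) (F := fun g => ‖f g‖)
      (fun h hh g => by simp only [f.isHeckeFun.left_inv _ hh]) γ
  refine ⟨Real.sqrt (A * B), Real.sqrt_nonneg _, fun ξ Q => ?_⟩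
  rw [Real.sq_sqrt (mul_nonneg hA0 hB0)]
  set P : Finset (RightCosets Γ) := Q.biUnion fun q => (f.isHeckeFun.finite_row q.out).toFinset
    with hP
  have memP : ∀ q ∈ Q, ∀ p : RightCosets Γ, f (q.out * p.out⁻¹) ≠ 0 → p ∈ P := by
    intro q hq p hp
    exact Finset.mem_biUnion.2 ⟨q, hq, by simpa using hp⟩
  have rowP : ∀ q ∈ Q, ∑ p ∈ P, ‖f (q.out * p.out⁻¹)‖ = A := by
    intro q hq
    rw [← rowSum q.out]
    refine (finsum_eq_sum_of_support_subset _ fun p hp => ?_).symm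
    exact memP q hq p (by simpa using hp)
  have colQ : ∀ p : RightCosets Γ, ∑ q ∈ Q, ‖f (q.out * p.out⁻¹)‖ ≤ B := by
    intro p
    rw [← colSum p.out⁻¹]
    set S := (f.isHeckeFun.finite_col p.out⁻¹).toFinset with hS
    rw [finsum_eq_sum_of_support_subset (s := Q ∪ S)]
    · exact Finset.sum_le_sum_of_subset_of_nonneg Finset.subset_union_left
        fun _ _ _ => norm_nonneg _
    · intro q hq
      exact Finset.mem_coe.2 (Finset.mem_union_right _ (by simpa [hS] using hq))
  have hrow : ∀ q ∈ Q, ‖heckeConv Γ f (pullback ξ) q.out‖ ^ 2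
      ≤ A * ∑ p ∈ P, ‖f (q.out * p.out⁻¹)‖ * ‖ξ p‖ ^ 2 := by
    intro q hq
    have e : heckeConv Γ f (pullback ξ) q.out = ∑ p ∈ P, f (q.out * p.out⁻¹) * ξ p := by
      unfold heckeConv
      rw [finsum_eq_sum_of_support_subset (s := P)]
      · exact Finset.sum_congr rfl fun p _ => by rw [pullback_out]
      · intro p hp
        exact memP q hq p (left_ne_zero_of_mul hp)
    rw [e, ← rowP q hq]
    calc ‖∑ p ∈ P, f (q.out * p.out⁻¹) * ξ p‖ ^ 2
        ≤ (∑ p ∈ P, ‖f (q.out * p.out⁻¹)‖ * ‖ξ p‖) ^ 2 := by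
          gcongr
          refine (norm_sum_le _ _).trans (le_of_eq ?_)
          exact Finset.sum_congr rfl fun p _ => norm_mul _ _
      _ ≤ _ := by
          refine Finset.sum_sq_le_sum_mul_sum_of_sq_le_mul P (fun p _ => norm_nonneg _)
            (fun p _ => mul_nonneg (norm_nonneg _) (sq_nonneg _)) fun p _ => le_of_eq (by ring)
  have hξ : ∑ p ∈ P, ‖ξ p‖ ^ 2 ≤ ‖ξ‖ ^ 2 := by
    have := lp.sum_rpow_le_norm_rpow (p := 2) (by simp) ξ P
    simpa using this
  calc ∑ q ∈ Q, ‖heckeConv Γ f (pullback ξ) q.out‖ ^ 2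
      ≤ ∑ q ∈ Q, A * ∑ p ∈ P, ‖f (q.out * p.out⁻¹)‖ * ‖ξ p‖ ^ 2 := Finset.sum_le_sum hrow
    _ = A * ∑ p ∈ P, (∑ q ∈ Q, ‖f (q.out * p.out⁻¹)‖) * ‖ξ p‖ ^ 2 := by
        rw [← Finset.mul_sum, Finset.sum_comm]
        simp_rw [Finset.sum_mul]
    _ ≤ A * ∑ p ∈ P, B * ‖ξ p‖ ^ 2 := by
        gcongr with p _
        exact colQ p
    _ = A * B * ∑ p ∈ P, ‖ξ p‖ ^ 2 := by rw [← Finset.mul_sum, mul_assoc]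
    _ ≤ A * B * ‖ξ‖ ^ 2 := by gcongr

/-- The operator `ξ ↦ f * ξ` of left convolution by `f` on `ℓ²(Γ \ G)`. -/
noncomputable def heckeOp (f : HeckeAlgebra Γ) : HeckeL2 Γ →L[ℂ] HeckeL2 Γ :=
  LinearMap.mkContinuousOfExistsBound
    { toFun := fun ξ => ⟨fun q => heckeConv Γ f (pullback ξ) q.out, by
        obtain ⟨C, _, hC⟩ := hecke_schur f
        refine memℓp_gen' (C := C ^ 2 * ‖ξ‖ ^ 2) fun Q => ?_
        simpa using hC ξ Q⟩
      map_add' := fun ξ η => lp.ext (funext fun q =>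
        HeckeAlgebra.conv_add f (pullback ξ) (pullback η) q.out)
      map_smul' := fun c ξ => lp.ext (funext fun q =>
        HeckeAlgebra.conv_smul c f (pullback ξ) q.out) }
    (by
      obtain ⟨C, hC0, hC⟩ := hecke_schur f
      refine ⟨C, fun ξ => lp.norm_le_of_forall_sum_le (p := 2) (by simp) (by positivity)
        fun Q => ?_⟩
      simpa [mul_pow] using hC ξ Q)

theorem heckeOp_apply (f : HeckeAlgebra Γ) (ξ : HeckeL2 Γ) (q : RightCosets Γ) :
    heckeOp f ξ q = heckeConv Γ f (pullback ξ) q.out := rfl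

theorem pullback_heckeOp (f : HeckeAlgebra Γ) (ξ : HeckeL2 Γ) :
    pullback (heckeOp f ξ) = heckeConv Γ f (pullback ξ) := by
  funext g
  exact out_mkRightCoset (heckeConv_left_inv f.isHeckeFun.left_inv) g

open Classical in
theorem heckeOp_single (f : HeckeAlgebra Γ) (p q : RightCosets Γ) (c : ℂ) :
    heckeOp f (lp.single 2 p c) q = f (q.out * p.out⁻¹) * c := by
  rw [heckeOp_apply]
  unfold heckeConv
  rw [finsum_eq_single _ p]
  · rw [pullback_out]
    simp
  · intro r hr
    rw [pullback_out, lp.single_apply_ne _ _ _ hr, mul_zero]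

open Classical in
theorem heckeOp_star (f : HeckeAlgebra Γ) : heckeOp (star f) = star (heckeOp f) := by
  have hs : ∀ (T : HeckeL2 Γ →L[ℂ] HeckeL2 Γ) (ξ : HeckeL2 Γ),
      HasSum (fun p => T (lp.single 2 p (ξ p))) (T ξ) := by
    intro T ξ
    exact (lp.hasSum_single (p := 2) (by simp) ξ).mapL T
  refine ContinuousLinearMap.ext fun ξ => ?_
  refine (hs _ ξ).unique ?_
  convert hs (star (heckeOp f)) ξ using 2 with p
  refine lp.ext (funext fun q => ?_)
  have h1 : ∀ η : HeckeL2 Γ, η q = inner ℂ (lp.single 2 q (1 : ℂ)) η := by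
    intro η
    rw [lp.inner_single_left]
    simp
  rw [h1 (star (heckeOp f) _), ContinuousLinearMap.star_eq_adjoint,
    ContinuousLinearMap.adjoint_inner_right, lp.inner_single_right, heckeOp_single, heckeOp_single]
  simp [HeckeAlgebra.star_apply, mul_comm]

variable (Γ) in
/-- The Hecke representation `λ` of `H(G, Γ)` on `ℓ²(Γ \ G)`, `λ(f) ξ = f * ξ`. -/
noncomputable def heckeRep : HeckeAlgebra Γ →⋆ₐ[ℂ] (HeckeL2 Γ →L[ℂ] HeckeL2 Γ) where
  toFun := heckeOp
  map_one' := ContinuousLinearMap.ext fun ξ => lp.ext (funext fun q => by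
    rw [heckeOp_apply]
    exact (congrFun (HeckeAlgebra.one_conv (pullback_left_inv _)) _).trans (pullback_out _ _))
  map_mul' f g := ContinuousLinearMap.ext fun ξ => lp.ext (funext fun q => by
    rw [mul_apply_eq_comp, heckeOp_apply, heckeOp_apply, pullback_heckeOp]
    exact congrFun (heckeConv_assoc f.isHeckeFun g.isHeckeFun) q.out)
  map_zero' := ContinuousLinearMap.ext fun ξ => lp.ext (funext fun q => by
    rw [heckeOp_apply]
    simp [heckeConv])
  map_add' f g := ContinuousLinearMap.ext fun ξ => lp.ext (funext fun q =>
    HeckeAlgebra.add_conv f g (pullback ξ) q.out)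
  commutes' c := ContinuousLinearMap.ext fun ξ => lp.ext (funext fun q => by
    rw [Algebra.algebraMap_eq_smul_one, heckeOp_apply, HeckeAlgebra.smul_conv]
    rw [show heckeConv Γ (1 : HeckeAlgebra Γ) (pullback ξ) q.out = ξ q from
      (congrFun (HeckeAlgebra.one_conv (pullback_left_inv _)) _).trans (pullback_out _ _)]
    rfl)
  map_star' := heckeOp_star

variable (Γ) in
/-- The Hecke C*-algebra `C*_r(G, Γ)`: the norm closure of the image of the Hecke representation. -/
noncomputable def heckeCStar : StarSubalgebra ℂ (HeckeL2 Γ →L[ℂ] HeckeL2 Γ) :=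
  (heckeRep Γ).range.topologicalClosure

end HeckeRep

/-! ### Group algebras and group C*-algebras of (discrete, additively written) abelian groups -/

section GroupCStar

variable (D : Type u) [AddCommGroup D]

namespace GroupAlg

variable {D}

/-- The involution on the complex group algebra: `(∑ c_g δ_g)^* = ∑ conj(c_g) δ_{-g}`. -/
noncomputable instance : Star (AddMonoidAlgebra ℂ D) :=
  ⟨fun f => AddMonoidAlgebra.ofCoeff
    ((f.coeff.mapRange (starRingEnd ℂ) (map_zero _)).equivMapDomain (Equiv.neg D))⟩

theorem coeff_star (f : AddMonoidAlgebra ℂ D) (g : D) :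
    (star f).coeff g = conj (f.coeff (-g)) := rfl

theorem star_single (g : D) (c : ℂ) :
    star (AddMonoidAlgebra.single g c) = AddMonoidAlgebra.single (-g) (conj c) := by
  classical
  ext h
  rw [coeff_star, AddMonoidAlgebra.coeff_single, AddMonoidAlgebra.coeff_single,
    Finsupp.single_apply, Finsupp.single_apply]
  by_cases e : g = -h
  · rw [if_pos e, if_pos (by rw [e, neg_neg])]
  · rw [if_neg e, if_neg (fun e' => e (by rw [← e', neg_neg])), map_zero]

theorem star_add' (f g : AddMonoidAlgebra ℂ D) : star (f + g) = star f + star g := by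
  ext h
  simp [coeff_star]

noncomputable instance : StarRing (AddMonoidAlgebra ℂ D) where
  star_involutive f := by
    ext h
    simp [coeff_star]
  star_add := star_add'
  star_mul f g := by
    induction f using AddMonoidAlgebra.induction_linear with
    | zero =>
      have : star (0 : AddMonoidAlgebra ℂ D) = 0 := by ext h; simp [coeff_star]
      simp [this]
    | add f f' hf hf' => rw [add_mul, star_add', hf, hf', star_add', mul_add]
    | single a c =>
      induction g using AddMonoidAlgebra.induction_linear with
      | zero =>
        have : star (0 : AddMonoidAlgebra ℂ D) = 0 := by ext h; simp [coeff_star]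
        simp [this]
      | add f f' hf hf' => rw [mul_add, star_add', hf, hf', star_add', add_mul]
      | single b d =>
        rw [AddMonoidAlgebra.single_mul_single, star_single, star_single, star_single,
          AddMonoidAlgebra.single_mul_single, map_mul, mul_comm (conj c), neg_add_rev]

instance : StarModule ℂ (AddMonoidAlgebra ℂ D) where
  star_smul c f := by
    ext h
    simp [coeff_star]

end GroupAlg

/-- C*-seminorms on the group algebra. -/
structure IsCStarSeminorm (p : Seminorm ℂ (AddMonoidAlgebra ℂ D)) : Prop where
  mul_le : ∀ a b, p (a * b) ≤ p a * p b
  star_mul_self : ∀ a, p (star a * a) = p a ^ 2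

/-- The index type of all C*-seminorms on the group algebra. -/
def CStarSeminorm : Type u := {p : Seminorm ℂ (AddMonoidAlgebra ℂ D) // IsCStarSeminorm D p}

variable {D}

theorem IsCStarSeminorm.one_le {p : Seminorm ℂ (AddMonoidAlgebra ℂ D)} (hp : IsCStarSeminorm D p) :
    p 1 ≤ 1 := by
  have h := hp.star_mul_self 1
  rw [star_one, one_mul] at h
  nlinarith [apply_nonneg p 1]

theorem IsCStarSeminorm.single_le {p : Seminorm ℂ (AddMonoidAlgebra ℂ D)}
    (hp : IsCStarSeminorm D p) (g : D) (c : ℂ) : p (AddMonoidAlgebra.single g c) ≤ ‖c‖ := by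
  have h := hp.star_mul_self (AddMonoidAlgebra.single g 1)
  rw [GroupAlg.star_single, AddMonoidAlgebra.single_mul_single, neg_add_cancel, map_one, one_mul,
    ← AddMonoidAlgebra.one_def] at h
  have h1 : p (AddMonoidAlgebra.single g 1) ≤ 1 := by
    have := hp.one_le
    nlinarith [apply_nonneg p (AddMonoidAlgebra.single g 1)]
  have e : AddMonoidAlgebra.single g c = c • AddMonoidAlgebra.single g (1 : ℂ) := by
    rw [AddMonoidAlgebra.smul_single, smul_eq_mul, mul_one]
  rw [e, map_smul_eq_mul]
  exact mul_le_of_le_one_right (norm_nonneg _) h1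

theorem IsCStarSeminorm.star_le {p : Seminorm ℂ (AddMonoidAlgebra ℂ D)}
    (hp : IsCStarSeminorm D p) (a : AddMonoidAlgebra ℂ D) : p a ≤ p (star a) := by
  have h := hp.star_mul_self a
  have h2 := hp.mul_le (star a) a
  rcases (apply_nonneg p a).eq_or_lt with h0 | h0
  · rw [← h0]
    exact apply_nonneg _ _
  · nlinarith

theorem cstarSeminorm_bddAbove (f : AddMonoidAlgebra ℂ D) :
    BddAbove (Set.range fun p : CStarSeminorm D => p.1 f) := by
  induction f using AddMonoidAlgebra.induction_linear with
  | zero =>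
    refine ⟨0, ?_⟩
    rintro _ ⟨p, rfl⟩
    simp
  | add f g hf hg =>
    obtain ⟨a, ha⟩ := hf
    obtain ⟨b, hb⟩ := hg
    refine ⟨a + b, ?_⟩
    rintro _ ⟨p, rfl⟩
    exact (map_add_le_add p.1 f g).trans (add_le_add (ha ⟨p, rfl⟩) (hb ⟨p, rfl⟩))
  | single g c =>
    refine ⟨‖c‖, ?_⟩
    rintro _ ⟨p, rfl⟩
    exact p.2.single_le g c

instance : Nonempty (CStarSeminorm D) := ⟨⟨0, by simp, by simp⟩⟩

/-- The greatest C*-seminorm on the group algebra: the supremum of all C*-seminorms. -/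
noncomputable def maxCStarNorm (f : AddMonoidAlgebra ℂ D) : ℝ := ⨆ p : CStarSeminorm D, p.1 f

theorem le_maxCStarNorm (p : CStarSeminorm D) (f : AddMonoidAlgebra ℂ D) :
    p.1 f ≤ maxCStarNorm f := le_ciSup (cstarSeminorm_bddAbove f) p

theorem maxCStarNorm_nonneg (f : AddMonoidAlgebra ℂ D) : 0 ≤ maxCStarNorm f :=
  Real.iSup_nonneg fun p => apply_nonneg p.1 f

theorem maxCStarNorm_mul_le (f g : AddMonoidAlgebra ℂ D) :
    maxCStarNorm (f * g) ≤ maxCStarNorm f * maxCStarNorm g :=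
  ciSup_le fun p => (p.2.mul_le f g).trans (mul_le_mul (le_maxCStarNorm p f)
    (le_maxCStarNorm p g) (apply_nonneg _ _) (maxCStarNorm_nonneg f))

theorem maxCStarNorm_smul (c : ℂ) (f : AddMonoidAlgebra ℂ D) :
    maxCStarNorm (c • f) = ‖c‖ * maxCStarNorm f := by
  unfold maxCStarNorm
  rw [Real.mul_iSup_of_nonneg (norm_nonneg c)]
  exact iSup_congr fun p => map_smul_eq_mul p.1 c f

theorem maxCStarNorm_star_mul_self (f : AddMonoidAlgebra ℂ D) :
    maxCStarNorm f * maxCStarNorm f ≤ maxCStarNorm (star f * f) := by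
  have h : maxCStarNorm f ≤ Real.sqrt (maxCStarNorm (star f * f)) := by
    refine ciSup_le fun p => Real.le_sqrt_of_sq_le ?_
    rw [← p.2.star_mul_self]
    exact le_maxCStarNorm p _
  calc _ ≤ Real.sqrt (maxCStarNorm (star f * f)) * Real.sqrt (maxCStarNorm (star f * f)) :=
        mul_le_mul h h (maxCStarNorm_nonneg f) (Real.sqrt_nonneg _)
    _ = _ := Real.mul_self_sqrt (maxCStarNorm_nonneg _)

theorem maxCStarNorm_star_le (f : AddMonoidAlgebra ℂ D) :
    maxCStarNorm (star f) ≤ maxCStarNorm f := by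
  refine ciSup_le fun p => (p.2.star_le (star f)).trans ?_
  rw [star_star]
  exact le_maxCStarNorm p f

variable (D)

/-- The group algebra equipped with its greatest C*-seminorm. -/
def PreGroupCStar : Type u := AddMonoidAlgebra ℂ D

namespace PreGroupCStar

noncomputable instance : CommRing (PreGroupCStar D) :=
  inferInstanceAs (CommRing (AddMonoidAlgebra ℂ D))

noncomputable instance : Algebra ℂ (PreGroupCStar D) :=
  inferInstanceAs (Algebra ℂ (AddMonoidAlgebra ℂ D))

noncomputable instance : StarRing (PreGroupCStar D) :=
  inferInstanceAs (StarRing (AddMonoidAlgebra ℂ D))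

instance : StarModule ℂ (PreGroupCStar D) :=
  inferInstanceAs (StarModule ℂ (AddMonoidAlgebra ℂ D))

/-- The greatest C*-seminorm as a seminorm of the additive group. -/
noncomputable def addGroupSeminorm : AddGroupSeminorm (PreGroupCStar D) where
  toFun := fun f => maxCStarNorm (D := D) f
  map_zero' := by
    have := maxCStarNorm_smul (0 : ℂ) (0 : AddMonoidAlgebra ℂ D)
    rw [zero_smul, norm_zero, zero_mul] at this
    exact this
  add_le' f g := ciSup_le fun p => (map_add_le_add p.1 f g).trans
    (add_le_add (le_maxCStarNorm p f) (le_maxCStarNorm p g))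
  neg' f := by
    have := maxCStarNorm_smul (-1 : ℂ) (show AddMonoidAlgebra ℂ D from f)
    rw [neg_smul, one_smul, norm_neg, norm_one, one_mul] at this
    exact this

noncomputable instance : SeminormedCommRing (PreGroupCStar D) where
  __ := (inferInstance : CommRing (PreGroupCStar D))
  __ := (addGroupSeminorm D).toSeminormedAddCommGroup
  norm_mul_le f g := maxCStarNorm_mul_le (D := D) f g

theorem norm_def (f : PreGroupCStar D) : ‖f‖ = maxCStarNorm (D := D) f := rfl

noncomputable instance : NormedAlgebra ℂ (PreGroupCStar D) where
  __ := (inferInstance : Algebra ℂ (PreGroupCStar D))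
  norm_smul_le c f := (maxCStarNorm_smul (D := D) c f).le

theorem norm_star_le (f : PreGroupCStar D) : ‖star f‖ ≤ ‖f‖ := maxCStarNorm_star_le (D := D) f

theorem norm_star_mul_self (f : PreGroupCStar D) : ‖f‖ * ‖f‖ ≤ ‖star f * f‖ :=
  maxCStarNorm_star_mul_self (D := D) f

theorem uniformContinuous_star : UniformContinuous (star : PreGroupCStar D → PreGroupCStar D) := by
  refine (LipschitzWith.of_dist_le_mul (K := 1) fun f g => ?_).uniformContinuous
  rw [dist_eq_norm, dist_eq_norm, ← star_sub, NNReal.coe_one, one_mul]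
  exact norm_star_le D _

end PreGroupCStar

/-- The (full) group C*-algebra `C*(D)` of the discrete abelian group `D`: the completion of the
group algebra `ℂ[D]` in its greatest C*-seminorm. -/
def GroupCStar : Type u := UniformSpace.Completion (PreGroupCStar D)

namespace GroupCStar

open UniformSpace

noncomputable instance : NormedCommRing (GroupCStar D) :=
  inferInstanceAs (NormedCommRing (Completion (PreGroupCStar D)))

noncomputable instance : NormedAlgebra ℂ (GroupCStar D) :=
  inferInstanceAs (NormedAlgebra ℂ (Completion (PreGroupCStar D)))

instance : CompleteSpace (GroupCStar D) :=
  inferInstanceAs (CompleteSpace (Completion (PreGroupCStar D)))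

variable {D}

/-- The canonical map from the group algebra. -/
noncomputable def ofPre (f : PreGroupCStar D) : GroupCStar D := (f : Completion (PreGroupCStar D))

theorem continuous_ofPre : Continuous (ofPre (D := D)) := Completion.continuous_coe _

theorem norm_ofPre (f : PreGroupCStar D) : ‖ofPre f‖ = ‖f‖ := Completion.norm_coe f

theorem ofPre_add (f g : PreGroupCStar D) : ofPre (f + g) = ofPre f + ofPre g :=
  Completion.coe_add f g

theorem ofPre_mul (f g : PreGroupCStar D) : ofPre (f * g) = ofPre f * ofPre g :=
  Completion.coe_mul f g

theorem ofPre_smul (c : ℂ) (f : PreGroupCStar D) : ofPre (c • f) = c • ofPre f :=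
  Completion.coe_smul c f

theorem induction {P : GroupCStar D → Prop} (x : GroupCStar D) (hc : IsClosed {x | P x})
    (h : ∀ f, P (ofPre f)) : P x := Completion.induction_on x hc h

theorem induction₂ {P : GroupCStar D → GroupCStar D → Prop} (x y : GroupCStar D)
    (hc : IsClosed {z : GroupCStar D × GroupCStar D | P z.1 z.2})
    (h : ∀ f g, P (ofPre f) (ofPre g)) : P x y := Completion.induction_on₂ x y hc h

/-- The involution, extended from the group algebra by continuity. -/
noncomputable instance : Star (GroupCStar D) :=
  ⟨Completion.map (star : PreGroupCStar D → PreGroupCStar D)⟩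

theorem star_ofPre (f : PreGroupCStar D) : star (ofPre f) = ofPre (star f) :=
  Completion.map_coe (PreGroupCStar.uniformContinuous_star D) f

@[fun_prop]
theorem continuous_star' : Continuous fun x : GroupCStar D => star x :=
  Completion.continuous_map

theorem star_smul_aux (c : ℂ) (x : GroupCStar D) : star (c • x) = star c • star x := by
  have h1 : Continuous fun x : GroupCStar D => star (c • x) :=
    continuous_star'.comp (continuous_const_smul c)
  have h2 : Continuous fun x : GroupCStar D => star c • star x :=
    continuous_star'.const_smul (star c)
  refine induction (P := fun x => star (c • x) = star c • star x) x (isClosed_eq h1 h2) fun f => ?_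
  rw [← ofPre_smul, star_ofPre, star_ofPre, star_smul, ofPre_smul]

noncomputable instance : CStarAlgebra (GroupCStar D) where
  __ := (inferInstance : NormedCommRing (GroupCStar D))
  __ := (inferInstance : NormedAlgebra ℂ (GroupCStar D))
  __ := (inferInstance : CompleteSpace (GroupCStar D))
  star_involutive x := by
    refine induction (P := fun x => star (star x) = x) x ?_ fun f => ?_
    · exact isClosed_eq (by fun_prop) (by fun_prop)
    · rw [star_ofPre, star_ofPre, star_star]
  star_mul x y := by
    refine induction₂ (P := fun x y => star (x * y) = star y * star x) x y ?_ fun f g => ?_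
    · exact isClosed_eq (by fun_prop) (by fun_prop)
    · rw [← ofPre_mul, star_ofPre, star_ofPre, star_ofPre, star_mul, ofPre_mul]
  star_add x y := by
    refine induction₂ (P := fun x y => star (x + y) = star x + star y) x y ?_ fun f g => ?_
    · exact isClosed_eq (by fun_prop) (by fun_prop)
    · rw [← ofPre_add, star_ofPre, star_ofPre, star_ofPre, star_add, ofPre_add]
  norm_mul_self_le x := by
    refine induction (P := fun x => ‖x‖ * ‖x‖ ≤ ‖star x * x‖) x ?_ fun f => ?_
    · exact isClosed_le (by fun_prop) (by fun_prop)
    · rw [star_ofPre, ← ofPre_mul, norm_ofPre, norm_ofPre]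
      exact PreGroupCStar.norm_star_mul_self D f
  star_smul c x := star_smul_aux c x

variable (D) in
/-- The canonical *-homomorphism `ℂ[D] → C*(D)`. -/
noncomputable def ofGroupAlg : AddMonoidAlgebra ℂ D →⋆ₐ[ℂ] GroupCStar D where
  toFun f := ofPre (show PreGroupCStar D from f)
  map_one' := rfl
  map_mul' f g := ofPre_mul (D := D) f g
  map_zero' := rfl
  map_add' f g := ofPre_add (D := D) f g
  commutes' c := by
    rw [Algebra.algebraMap_eq_smul_one, Algebra.algebraMap_eq_smul_one]
    exact ofPre_smul (D := D) c 1
  map_star' f := (star_ofPre (D := D) f).symm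

end GroupCStar

end GroupCStar

/-! ### The `ax + b` groups of a number field -/

/-- The group `P_F` of matrices `(1 y; 0 x)` with `y ∈ F` and `x ∈ Fˣ`, under matrix
multiplication. -/
@[ext]
structure AffGroup (F : Type u) [Field F] : Type u where
  /-- the upper right entry -/
  y : F
  /-- the lower right entry -/
  x : Fˣ

namespace AffGroup

variable {F : Type u} [Field F]

instance : Mul (AffGroup F) := ⟨fun g h => ⟨h.y + g.y * h.x, g.x * h.x⟩⟩
instance : One (AffGroup F) := ⟨⟨0, 1⟩⟩
instance : Inv (AffGroup F) := ⟨fun g => ⟨-(g.y * (g.x⁻¹ : Fˣ)), g.x⁻¹⟩⟩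

@[simp] theorem mul_y (g h : AffGroup F) : (g * h).y = h.y + g.y * h.x := rfl
@[simp] theorem mul_x (g h : AffGroup F) : (g * h).x = g.x * h.x := rfl
@[simp] theorem one_y : (1 : AffGroup F).y = 0 := rfl
@[simp] theorem one_x : (1 : AffGroup F).x = 1 := rfl
@[simp] theorem inv_y (g : AffGroup F) : (g⁻¹).y = -(g.y * (g.x⁻¹ : Fˣ)) := rfl
@[simp] theorem inv_x (g : AffGroup F) : (g⁻¹).x = g.x⁻¹ := rfl

instance : Group (AffGroup F) :=
  Group.ofLeftAxioms
    (fun a b c => AffGroup.ext (by simp only [mul_y, mul_x, Units.val_mul]; ring)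
      (by simp only [mul_x, mul_assoc]))
    (fun a => AffGroup.ext (by simp) (by simp))
    (fun a => AffGroup.ext (by simp) (by simp))

/-- The matrix `(1 y; 0 x)`. -/
def toMatrix (g : AffGroup F) : Matrix (Fin 2) (Fin 2) F := !![1, g.y; 0, (g.x : F)]

theorem toMatrix_mul (g h : AffGroup F) : toMatrix (g * h) = toMatrix g * toMatrix h := by
  simp [toMatrix]

end AffGroup

section NumberField

variable (K : Type u) [Field K]

/-- The subgroup `P_𝓞` of `P_K`: matrices `(1 a; 0 u)` with `a ∈ 𝓞` and `u ∈ 𝓞ˣ`. -/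
def intAffGroup : Subgroup (AffGroup K) where
  carrier := {g | (∃ a : 𝓞 K, (a : K) = g.y) ∧ ∃ u : (𝓞 K)ˣ, ((u : 𝓞 K) : K) = g.x}
  one_mem' := ⟨⟨0, by simp⟩, 1, by simp⟩
  mul_mem' := by
    rintro g h ⟨⟨a, ha⟩, u, hu⟩ ⟨⟨b, hb⟩, v, hv⟩
    exact ⟨⟨b + a * v, by simp [ha, hb, hv]⟩, u * v, by simp [hu, hv]⟩
  inv_mem' := by
    rintro g ⟨⟨a, ha⟩, u, hu⟩
    have hi : (((u⁻¹ : (𝓞 K)ˣ) : 𝓞 K) : K) = ((g.x⁻¹ : Kˣ) : K) := by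
      rw [Units.val_inv_eq_inv_val, ← hu]
      refine eq_inv_of_mul_eq_one_left ?_
      rw [← map_mul, Units.inv_mul, map_one]
    exact ⟨⟨-(a * (u⁻¹ : (𝓞 K)ˣ)), by simp [ha, hi]⟩, u⁻¹, hi⟩

/-- `𝓞` as an `𝓞`-submodule of `K`. -/
abbrev intSubmodule : Submodule (𝓞 K) K := LinearMap.range (Algebra.linearMap (𝓞 K) K)

/-- The quotient `K/𝓞`, an `𝓞`-module on which `𝓞ˣ` acts by multiplication.  The group `𝓞ˣ_r` of
units fixing `r` modulo `𝓞` is `MulAction.stabilizer (𝓞 K)ˣ r`. -/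
abbrev KModO : Type u := K ⧸ intSubmodule K

variable {K}

/-- The class of `y ∈ K` in `K/𝓞`. -/
abbrev KModO.mk (y : K) : KModO K := (intSubmodule K).mkQ y

theorem KModO.mk_eq_iff {y z : K} : KModO.mk y = KModO.mk z ↔ ∃ a : 𝓞 K, (a : K) = y - z := by
  exact Submodule.Quotient.eq (intSubmodule K)

/-- The matrix `(1 y; 0 1)`. -/
def transl (y : K) : AffGroup K := ⟨y, 1⟩

theorem doubleCoset_transl {y z : K} (h : KModO.mk y = KModO.mk z) :
    DoubleCoset.doubleCoset (transl y) (intAffGroup K : Set (AffGroup K)) (intAffGroup K)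
      = DoubleCoset.doubleCoset (transl z) (intAffGroup K : Set (AffGroup K)) (intAffGroup K) := by
  obtain ⟨a, ha⟩ := KModO.mk_eq_iff.1 h
  refine DoubleCoset.doubleCoset_eq_of_mem (DoubleCoset.mem_doubleCoset.2
    ⟨transl (a : K), ⟨⟨a, rfl⟩, 1, by simp [transl]⟩, 1, (intAffGroup K).one_mem, ?_⟩)
  ext
  · simp [transl, ha]
  · simp [transl]

theorem char_transl {y z : K} (h : KModO.mk y = KModO.mk z) :
    HeckeAlgebra.char (intAffGroup K) (transl y) = HeckeAlgebra.char (intAffGroup K) (transl z) := by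
  classical
  refine HeckeAlgebra.ext fun g => ?_
  exact if_congr (by rw [doubleCoset_transl h]) rfl rfl

theorem numRightCosets_transl {y z : K} (h : KModO.mk y = KModO.mk z) :
    numRightCosets (intAffGroup K) (transl y) = numRightCosets (intAffGroup K) (transl z) := by
  simp only [numRightCosets, rightCosetsIn, doubleCoset_transl h]

variable [NumberField K]

/-- A finiteness principle: a map on `𝓞 × 𝓞ˣ` which only depends on residues modulo a
nonzero `n ∈ 𝓞` has finite range. -/
theorem finite_range_of_mod {α : Type*} (F : 𝓞 K × (𝓞 K)ˣ → α) {n : 𝓞 K} (hn : n ≠ 0)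
    (hF : ∀ (a : 𝓞 K) (u : (𝓞 K)ˣ) (b : 𝓞 K) (v : (𝓞 K)ˣ), n ∣ b - a → n ∣ (v : 𝓞 K) - (u : 𝓞 K) → F (a, u) = F (b, v)) :
    (Set.range F).Finite := by
  have hI : Ideal.span {n} ≠ ⊥ := by simpa using hn
  have : Finite (𝓞 K ⧸ Ideal.span {n}) := Ideal.finiteQuotientOfFreeOfNeBot _ hI
  let π : 𝓞 K × (𝓞 K)ˣ → (𝓞 K ⧸ Ideal.span {n}) × (𝓞 K ⧸ Ideal.span {n}) :=
    fun p => (Ideal.Quotient.mk _ p.1, Ideal.Quotient.mk _ (p.2 : 𝓞 K))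
  have key : ∀ p q, π p = π q → F p = F q := by
    rintro ⟨a, u⟩ ⟨b, v⟩ h
    have h1 := (Ideal.Quotient.eq.1 (congrArg Prod.fst h).symm)
    have h2 := (Ideal.Quotient.eq.1 (congrArg Prod.snd h).symm)
    exact hF a u b v (Ideal.mem_span_singleton.1 h1) (Ideal.mem_span_singleton.1 h2)
  have : Set.range F ⊆ Set.range fun z : Set.range π => F z.2.choose := by
    rintro _ ⟨p, rfl⟩
    exact ⟨⟨π p, p, rfl⟩, key _ _ (⟨π p, p, rfl⟩ : Set.range π).2.choose_spec⟩
  exact (Set.finite_range _).subset this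

theorem exists_denom (z : K) : ∃ n : 𝓞 K, n ≠ 0 ∧ ∃ a : 𝓞 K, (a : K) = n * z := by
  obtain ⟨a, b, hb, rfl⟩ := IsFractionRing.div_surjective (A := 𝓞 K) z
  have hb0 : b ≠ 0 := nonZeroDivisors.ne_zero hb
  refine ⟨b, hb0, a, ?_⟩
  rw [mul_div_cancel₀]
  simpa using hb0

instance : IsHeckePair (intAffGroup K) where
  finite_rightCosetsIn := by
    intro g
    obtain ⟨n, hn, c, hc⟩ := exists_denom ((g.x⁻¹ : Kˣ) : K)
    obtain ⟨m, hm, d, hd⟩ := exists_denom (g.y * ((g.x⁻¹ : Kˣ) : K))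
    let F : 𝓞 K × (𝓞 K)ˣ → RightCosets (intAffGroup K) := fun p =>
      mkRightCoset _ (g * ⟨(p.1 : K), Units.map (algebraMap (𝓞 K) K).toMonoidHom p.2⟩)
    have hfin : (Set.range F).Finite := by
      refine finite_range_of_mod F (mul_ne_zero hn hm) ?_
      rintro a u b v ⟨s, hs⟩ ⟨t, ht⟩
      refine mkRightCoset_eq_iff.2 ?_
      have hs' : (b : K) - a = n * m * s := by
        have := congrArg (algebraMap (𝓞 K) K) hs
        simpa using this
      have ht' : ((v : 𝓞 K) : K) - ((u : 𝓞 K) : K) = n * m * t := by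
        have := congrArg (algebraMap (𝓞 K) K) ht
        simpa using this
      have hu : ((u : 𝓞 K) : K) ≠ 0 := by simp
      have hx : (g.x : K) ≠ 0 := g.x.ne_zero
      rw [Units.val_inv_eq_inv_val] at hc hd
      have hui : (((u⁻¹ : (𝓞 K)ˣ) : 𝓞 K) : K) = ((u : 𝓞 K) : K)⁻¹ := by
        refine eq_inv_of_mul_eq_one_left ?_
        rw [← map_mul, Units.inv_mul, map_one]
      refine ⟨⟨(c * m * s + d * n * t) * (u⁻¹ : (𝓞 K)ˣ), ?_⟩, v * u⁻¹, ?_⟩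
      · simp only [AffGroup.mul_y, AffGroup.inv_y, AffGroup.mul_x, AffGroup.inv_x, mul_inv_rev,
          Units.val_mul, map_mul, map_add, hc, hd, hui, Units.val_inv_eq_inv_val, Units.coe_map]
        simp only [RingHom.toMonoidHom_eq_coe, MonoidHom.coe_coe]
        field_simp
        linear_combination (-1 : K) * hs' - g.y * ht'
      · simp only [AffGroup.mul_x, AffGroup.inv_x, mul_inv_rev,
          Units.val_mul, map_mul, hui, Units.val_inv_eq_inv_val, Units.coe_map]
        simp only [RingHom.toMonoidHom_eq_coe, MonoidHom.coe_coe]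
        field_simp
    refine hfin.subset ?_
    rintro _ ⟨γ, hγ, rfl⟩
    obtain ⟨h, hh, k, ⟨⟨a, ha⟩, u, hu⟩, rfl⟩ := DoubleCoset.mem_doubleCoset.1 hγ
    refine ⟨(a, u), ?_⟩
    have hk : k = ⟨(a : K), Units.map (algebraMap (𝓞 K) K).toMonoidHom u⟩ :=
      AffGroup.ext ha.symm (Units.ext hu.symm)
    refine mkRightCoset_eq_iff.2 ?_
    rw [hk]
    simpa using hh

instance finite_units_quotient (r : KModO K) :
    Finite ((𝓞 K)ˣ ⧸ MulAction.stabilizer (𝓞 K)ˣ r) := by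
  have hfin : (Set.range fun u : (𝓞 K)ˣ => u • r).Finite := by
    obtain ⟨y, rfl⟩ := (intSubmodule K).mkQ_surjective r
    obtain ⟨n, hn, c, hc⟩ := exists_denom y
    have := finite_range_of_mod (fun p : 𝓞 K × (𝓞 K)ˣ => p.2 • KModO.mk y) hn (by
      rintro a u b v - ⟨t, ht⟩
      have hv : (v : 𝓞 K) = u + n * t := by rw [← ht]; ring
      show (u : 𝓞 K) • KModO.mk y = (v : 𝓞 K) • KModO.mk y
      rw [← map_smul, ← map_smul, eq_comm, KModO.mk_eq_iff]
      refine ⟨c * t, ?_⟩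
      rw [hv, Algebra.smul_def, Algebra.smul_def]
      simp only [map_add, map_mul, hc]
      ring)
    refine this.subset ?_
    rintro _ ⟨u, rfl⟩
    exact ⟨(0, u), rfl⟩
  have : Finite (MulAction.orbit (𝓞 K)ˣ r) := hfin.to_subtype
  exact Finite.of_equiv _ (MulAction.orbitEquivQuotientStabilizer (𝓞 K)ˣ r)

noncomputable instance (r : KModO K) : Fintype ((𝓞 K)ˣ ⧸ MulAction.stabilizer (𝓞 K)ˣ r) :=
  Fintype.ofFinite _

/-- `R(r)`: the number of right cosets in the double coset of `(1 r; 0 1)`, for `r ∈ K/𝓞`. -/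
noncomputable def cosetCount (r : KModO K) : ℕ :=
  Quotient.liftOn' r (fun y => numRightCosets (intAffGroup K) (transl y)) (by
    intro y z h
    exact numRightCosets_transl (Quotient.sound' h))

variable (K) in
/-- The Hecke algebra `H(P_K, P_𝓞)`. -/
abbrev HeckeK : Type u := HeckeAlgebra (intAffGroup K)

/-- `θ_r = R(r)⁻¹ [P_𝓞 (1 r; 0 1) P_𝓞]`, for `r ∈ K/𝓞`. -/
noncomputable def theta (r : KModO K) : HeckeK K :=
  Quotient.liftOn' r (fun y => (1 / (numRightCosets (intAffGroup K) (transl y) : ℂ)) •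
    HeckeAlgebra.char (intAffGroup K) (transl y)) (by
    intro y z h
    have h' : KModO.mk y = KModO.mk z := Quotient.sound' h
    simp only [numRightCosets_transl h', char_transl h'])

/-- The relations
`x_0 = 1`, `x_{wr} = x_r = x_r^*`,
`x_r x_s = R(r)⁻¹ R(s)⁻¹ ∑_{u ∈ 𝓞ˣ/𝓞ˣ_r} ∑_{v ∈ 𝓞ˣ/𝓞ˣ_s} x_{ur + vs}`
for a family `x` in a unital *-algebra, indexed by `K/𝓞`. -/
structure ThetaRelations {B : Type*} [Ring B] [StarRing B] [Algebra ℂ B] (x : KModO K → B) :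
    Prop where
  zero : x 0 = 1
  unit_smul : ∀ (w : (𝓞 K)ˣ) (r : KModO K), x (w • r) = x r
  star_eq : ∀ r : KModO K, star (x r) = x r
  mul_eq : ∀ r s : KModO K, x r * x s =
    ((1 / (cosetCount r : ℂ)) * (1 / (cosetCount s : ℂ))) •
      ∑ u : (𝓞 K)ˣ ⧸ MulAction.stabilizer (𝓞 K)ˣ r, ∑ v : (𝓞 K)ˣ ⧸ MulAction.stabilizer (𝓞 K)ˣ s,
        x (MulAction.ofQuotientStabilizer (𝓞 K)ˣ r u + MulAction.ofQuotientStabilizer (𝓞 K)ˣ s v)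

variable (K) in
/-- The *-subalgebra `𝔄` of `H(P_K, P_𝓞)` generated by the `θ_r`. -/
noncomputable def thetaAlg : StarSubalgebra ℂ (HeckeK K) :=
  StarAlgebra.adjoin ℂ (Set.range (theta (K := K)))

/-- `θ_r` as an element of `𝔄`. -/
noncomputable def thetaGen (r : KModO K) : thetaAlg K :=
  ⟨theta r, StarAlgebra.subset_adjoin ℂ _ ⟨r, rfl⟩⟩

/-- `𝔄(d)`: the linear span of the `θ_r` with `r ∈ K`, `r d ∈ 𝓞`. -/
noncomputable def thetaSpan (d : 𝓞 K) : Submodule ℂ (HeckeK K) :=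
  Submodule.span ℂ {h | ∃ r : K, (∃ a : 𝓞 K, (a : K) = r * d) ∧ h = theta (KModO.mk r)}

variable (K) in
/-- The C*-algebra `A_θ` generated by the image of `𝔄` under the Hecke representation. -/
noncomputable def thetaCStar :
    StarSubalgebra ℂ (HeckeL2 (intAffGroup K) →L[ℂ] HeckeL2 (intAffGroup K)) :=
  ((thetaAlg K).map (heckeRep (intAffGroup K))).topologicalClosure

/-- `λ(θ_r)` as an element of `A_θ`. -/
noncomputable def thetaCStarGen (r : KModO K) : thetaCStar K :=
  ⟨heckeRep (intAffGroup K) (theta r), StarSubalgebra.le_topologicalClosure _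
    ⟨theta r, (thetaGen r).2, rfl⟩⟩

/-- The unit-orbit average `R(r)⁻¹ ∑_{u ∈ 𝓞ˣ/𝓞ˣ_r} δ_{ur}` in the group algebra `ℂ[K/𝓞]`. -/
noncomputable def orbitAverage (r : KModO K) : AddMonoidAlgebra ℂ (KModO K) :=
  (1 / (cosetCount r : ℂ)) • ∑ u : (𝓞 K)ˣ ⧸ MulAction.stabilizer (𝓞 K)ˣ r,
    AddMonoidAlgebra.single (MulAction.ofQuotientStabilizer (𝓞 K)ˣ r u) 1

end NumberField

/-!
Let `ℂ[K/𝓞]^{𝓞ˣ}` be the *-algebra of `𝓞ˣ`-invariant elements of the group algebra. A Hecke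
function supported on matrices with determinant in `𝓞ˣ` is determined by its restriction to the
translations `(1 y; 0 1)`, and the restriction is multiplicative because the only right cosets that
contribute to a convolution are those of translations. This embeds `𝔄` into `ℂ[K/𝓞]^{𝓞ˣ}` as a
*-algebra, with `θ_r ↦ ϑ_r`. Averaging over orbits is self-adjoint, so an invariant `a` equals
`∑ a_r ϑ_r`; hence relations (II) for `x` say exactly that the linear extension of `δ_r ↦ x_r` is a
unital *-homomorphism on invariant elements, which is the universal property of `𝔄`.

Each `f ∈ 𝔄` lies in some `𝔄(d)`, which is finite-dimensional. A finite-dimensional *-algebra with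
an injective *-homomorphism to a C*-algebra is itself a C*-algebra, and *-homomorphisms out of it
are contractive; so any two injective *-homomorphisms from `𝔄` to C*-algebras induce the same norm
and dominate every other one. Together with the injectivity of `λ` this gives the universal property
of `A_θ`, and together with the injectivity of `ℂ[K/𝓞] → C*(K/𝓞)` the isometric embedding. The last
injectivity holds because characters with values in the circle separate the points of `K/𝓞` and
distinct characters (here: evaluations at distinct points, on the dual group) are linearly
independent.
-/

section LinearExtension

variable {R D M N : Type*} [CommSemiring R] [AddCommMonoid M] [Module R M] [AddCommMonoid N]
  [Module R N]

/-- The linear map `R[D] → M` with `δ_d ↦ x_d`: the counterpart of `AddMonoidAlgebra.lift` for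
families which need not be multiplicative. -/
noncomputable def linearExtension (x : D → M) : AddMonoidAlgebra R D →ₗ[R] M :=
  Finsupp.linearCombination R x ∘ₗ (AddMonoidAlgebra.coeffLinearEquiv R).toLinearMap

theorem linearExtension_apply (x : D → M) (a : AddMonoidAlgebra R D) :
    linearExtension x a = a.coeff.sum fun d c => c • x d := rfl

theorem linearExtension_single (x : D → M) (d : D) (c : R) :
    linearExtension x (AddMonoidAlgebra.single d c) = c • x d :=
  Finsupp.linearCombination_single R c d

theorem map_linearExtension (φ : M →ₗ[R] N) (x : D → M) (a : AddMonoidAlgebra R D) :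
    φ (linearExtension x a) = linearExtension (fun d => φ (x d)) a := by
  simp only [linearExtension_apply, map_finsuppSum, map_smul]

theorem linearExtension_mem_span (x : D → M) (a : AddMonoidAlgebra R D) :
    linearExtension x a ∈ Submodule.span R (Set.range x) :=
  Finsupp.mem_span_range_iff_exists_finsupp.2 ⟨a.coeff, rfl⟩

theorem linearExtension_coeff_comm (a b : AddMonoidAlgebra R D) :
    linearExtension b.coeff a = linearExtension a.coeff b := by
  classical
  rw [linearExtension_apply, linearExtension_apply,
    Finsupp.sum_of_support_subset _ (Finset.subset_union_left (s₂ := b.coeff.support)) _ (by simp),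
    Finsupp.sum_of_support_subset _ (Finset.subset_union_right (s₁ := a.coeff.support)) _ (by simp)]
  exact Finset.sum_congr rfl fun d _ => mul_comm _ _

end LinearExtension

section Orbits

variable {U X : Type*} [Group U] [MulAction U X] (r : X) [Fintype (U ⧸ MulAction.stabilizer U r)]

theorem sum_ofQuotientStabilizer_of_invariant {M : Type*} [AddCommMonoid M] {f : X → M}
    (hf : ∀ w : U, f (w • r) = f r) :
    ∑ u : U ⧸ MulAction.stabilizer U r, f (MulAction.ofQuotientStabilizer U r u) =
      Fintype.card (U ⧸ MulAction.stabilizer U r) • f r := by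
  have hconst (u : U ⧸ MulAction.stabilizer U r) :
      f (MulAction.ofQuotientStabilizer U r u) = f r := by
    obtain ⟨w, hw⟩ := MulAction.ofQuotientStabilizer_mem_orbit U r u
    exact hw ▸ hf w
  simp only [hconst, Finset.sum_const, Finset.card_univ]

open Classical in
theorem sum_ofQuotientStabilizer_ite_eq {M : Type*} [AddCommMonoid M] (x : X) (c : M) :
    ∑ u : U ⧸ MulAction.stabilizer U r,
      (if MulAction.ofQuotientStabilizer U r u = x then c else 0) =
      if x ∈ MulAction.orbit U r then c else 0 := by
  split_ifs with h
  · obtain ⟨w, rfl⟩ := h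
    have hw (u : U ⧸ MulAction.stabilizer U r) :
        MulAction.ofQuotientStabilizer U r u = w • r ↔ u = w :=
      (MulAction.injective_ofQuotientStabilizer U r).eq_iff' rfl
    simp only [hw, Finset.sum_ite_eq', Finset.mem_univ, if_true]
  · refine Finset.sum_eq_zero fun u _ => if_neg fun hu => h ?_
    exact hu ▸ MulAction.ofQuotientStabilizer_mem_orbit U r u

end Orbits

section AffineGroup

variable {K : Type u} [Field K]

theorem KModO.mk_surjective : Function.Surjective (KModO.mk : K → KModO K) :=
  (intSubmodule K).mkQ_surjective

theorem KModO.mk_eq_zero_iff {y : K} : KModO.mk y = 0 ↔ ∃ a : 𝓞 K, (a : K) = y := by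
  rw [← map_zero (intSubmodule K).mkQ, KModO.mk_eq_iff, sub_zero]

theorem KModO.unit_smul_mk (w : (𝓞 K)ˣ) (y : K) :
    w • KModO.mk y = KModO.mk (((w : 𝓞 K) : K) * y) := by
  rw [Units.smul_def, ← map_smul, Algebra.smul_def]

theorem KModO.neg_one_smul (r : KModO K) : (-1 : (𝓞 K)ˣ) • r = -r := by
  rw [Units.smul_def, Units.val_neg, Units.val_one, neg_smul, one_smul]

variable (K) in
/-- The image of `𝓞ˣ` in `Kˣ`. -/
def unitsRange : Subgroup Kˣ := (Units.map (algebraMap (𝓞 K) K).toMonoidHom).range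

/-- The element `(1 a; 0 u)` of `P_𝓞`. -/
def intAff (a : 𝓞 K) (u : (𝓞 K)ˣ) : AffGroup K :=
  ⟨a, Units.map (algebraMap (𝓞 K) K).toMonoidHom u⟩

@[simp] theorem intAff_y (a : 𝓞 K) (u : (𝓞 K)ˣ) : (intAff a u).y = a := rfl

@[simp] theorem intAff_x (a : 𝓞 K) (u : (𝓞 K)ˣ) :
    (intAff a u).x = Units.map (algebraMap (𝓞 K) K).toMonoidHom u := rfl

theorem intAff_mem (a : 𝓞 K) (u : (𝓞 K)ˣ) : intAff a u ∈ intAffGroup K :=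
  ⟨⟨a, rfl⟩, u, rfl⟩

theorem mem_intAffGroup_iff {g : AffGroup K} :
    g ∈ intAffGroup K ↔ ∃ (a : 𝓞 K) (u : (𝓞 K)ˣ), g = intAff a u := by
  constructor
  · rintro ⟨⟨a, ha⟩, u, hu⟩
    exact ⟨a, u, AffGroup.ext ha.symm (Units.ext hu.symm)⟩
  · rintro ⟨a, u, rfl⟩
    exact intAff_mem a u

@[simp] theorem transl_y (y : K) : (transl y).y = y := rfl

@[simp] theorem transl_x (y : K) : (transl y).x = 1 := rfl

theorem transl_inv (y : K) : (transl y)⁻¹ = transl (-y) := by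
  ext <;> simp

theorem transl_mul_transl_inv (y z : K) : transl y * (transl z)⁻¹ = transl (y - z) := by
  ext <;> simp [sub_eq_neg_add]

theorem transl_mem_iff {y : K} : transl y ∈ intAffGroup K ↔ ∃ a : 𝓞 K, (a : K) = y :=
  ⟨fun h => h.1, fun h => ⟨h, 1, by simp⟩⟩

theorem mkRightCoset_transl_eq_iff {y z : K} :
    mkRightCoset (intAffGroup K) (transl y) = mkRightCoset (intAffGroup K) (transl z) ↔
      KModO.mk y = KModO.mk z := by
  rw [mkRightCoset_eq_iff, transl_mul_transl_inv, transl_mem_iff, ← KModO.mk_eq_iff, eq_comm]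

theorem exists_eq_intAff_mul_transl {g : AffGroup K} (hg : g.x ∈ unitsRange K) :
    ∃ u : (𝓞 K)ˣ, g = intAff 0 u * transl g.y := by
  obtain ⟨u, hu⟩ := hg
  exact ⟨u, AffGroup.ext (by simp) (by simp [← hu])⟩

theorem mem_doubleCoset_transl {g : AffGroup K} {y : K} :
    g ∈ DoubleCoset.doubleCoset (transl y) (intAffGroup K : Set (AffGroup K)) (intAffGroup K) ↔
      g.x ∈ unitsRange K ∧ KModO.mk g.y ∈ MulAction.orbit (𝓞 K)ˣ (KModO.mk y) := by
  rw [DoubleCoset.mem_doubleCoset]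
  constructor
  · rintro ⟨h, hh, k, hk, rfl⟩
    obtain ⟨a, u, rfl⟩ := mem_intAffGroup_iff.1 hh
    obtain ⟨b, v, rfl⟩ := mem_intAffGroup_iff.1 hk
    refine ⟨⟨u * v, by simp⟩, MulAction.mem_orbit_iff.2 ⟨v, ?_⟩⟩
    rw [KModO.unit_smul_mk, eq_comm, KModO.mk_eq_iff]
    refine ⟨b + a * v, ?_⟩
    simp only [map_add, map_mul, AffGroup.mul_y, intAff_y, transl_y, transl_x, Units.val_one,
      mul_one, intAff_x, RingHom.toMonoidHom_eq_coe, Units.coe_map, MonoidHom.coe_coe]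
    ring
  · rintro ⟨⟨v, hv⟩, horbit⟩
    obtain ⟨u, hu⟩ := MulAction.mem_orbit_iff.1 horbit
    rw [KModO.unit_smul_mk, eq_comm, KModO.mk_eq_iff] at hu
    obtain ⟨a, ha⟩ := hu
    refine ⟨_, intAff_mem 0 (v * u⁻¹), _, intAff_mem a u, ?_⟩
    ext
    · simp only [AffGroup.mul_y, intAff_y, ha, transl_y, map_zero, transl_x, Units.val_one, mul_one,
        add_zero, intAff_x, RingHom.toMonoidHom_eq_coe, Units.coe_map, MonoidHom.coe_coe]
      ring
    · rw [← hv]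
      simp

/-- The right coset of `(1 y; 0 1)`, as a function of the class of `y` in `K/𝓞`. -/
def translCoset (r : KModO K) : RightCosets (intAffGroup K) :=
  Quotient.liftOn' r (fun y => mkRightCoset _ (transl y)) fun _ _ h =>
    mkRightCoset_transl_eq_iff.2 (Quotient.sound' h)

theorem translCoset_mk (y : K) :
    translCoset (KModO.mk y) = mkRightCoset (intAffGroup K) (transl y) := rfl

theorem translCoset_injective : Function.Injective (translCoset (K := K)) := by
  intro r s h
  obtain ⟨y, rfl⟩ := KModO.mk_surjective r
  obtain ⟨z, rfl⟩ := KModO.mk_surjective s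
  exact mkRightCoset_transl_eq_iff.1 h

theorem translCoset_mk_eq_mkRightCoset {g : AffGroup K} (hg : g.x ∈ unitsRange K) :
    translCoset (KModO.mk g.y) = mkRightCoset (intAffGroup K) g := by
  obtain ⟨u, hu⟩ := exists_eq_intAff_mul_transl hg
  rw [translCoset_mk, mkRightCoset_eq_iff]
  nth_rw 1 [hu]
  simpa using intAff_mem 0 u

theorem rightCosetsIn_transl (y : K) :
    rightCosetsIn (intAffGroup K) (transl y) =
      translCoset '' MulAction.orbit (𝓞 K)ˣ (KModO.mk y) := by
  ext q
  constructor
  · rintro ⟨g, hg, rfl⟩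
    obtain ⟨hdet, horbit⟩ := mem_doubleCoset_transl.1 hg
    exact ⟨_, horbit, translCoset_mk_eq_mkRightCoset hdet⟩
  · rintro ⟨r, hr, rfl⟩
    obtain ⟨z, rfl⟩ := KModO.mk_surjective r
    exact ⟨transl z, mem_doubleCoset_transl.2 ⟨one_mem _, hr⟩, rfl⟩

theorem cosetCount_eq_ncard_orbit (r : KModO K) :
    cosetCount r = (MulAction.orbit (𝓞 K)ˣ r).ncard := by
  obtain ⟨y, rfl⟩ := KModO.mk_surjective r
  change (rightCosetsIn (intAffGroup K) (transl y)).ncard = _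
  rw [rightCosetsIn_transl, Set.ncard_image_of_injective _ translCoset_injective]

theorem cosetCount_eq_of_mem_orbit {r s : KModO K} (h : s ∈ MulAction.orbit (𝓞 K)ˣ r) :
    cosetCount s = cosetCount r := by
  rw [cosetCount_eq_ncard_orbit, cosetCount_eq_ncard_orbit, MulAction.orbit_eq_iff.2 h]

variable [NumberField K]

theorem cosetCount_eq_card (r : KModO K) :
    cosetCount r = Fintype.card ((𝓞 K)ˣ ⧸ MulAction.stabilizer (𝓞 K)ˣ r) := by
  rw [cosetCount_eq_ncard_orbit, ← Nat.card_coe_set_eq,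
    Nat.card_congr (MulAction.orbitEquivQuotientStabilizer (𝓞 K)ˣ r), Nat.card_eq_fintype_card]

theorem cosetCount_ne_zero (r : KModO K) : (cosetCount r : ℂ) ≠ 0 := by
  rw [cosetCount_eq_card]
  exact_mod_cast Fintype.card_ne_zero

end AffineGroup

section OrbitAverages

variable {K : Type u} [Field K] [NumberField K]

theorem one_div_cosetCount_smul_sum {M : Type*} [AddCommGroup M] [Module ℂ M] {f : KModO K → M}
    {r : KModO K} (hf : ∀ w : (𝓞 K)ˣ, f (w • r) = f r) :
    (1 / (cosetCount r : ℂ)) • ∑ u : (𝓞 K)ˣ ⧸ MulAction.stabilizer (𝓞 K)ˣ r,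
      f (MulAction.ofQuotientStabilizer (𝓞 K)ˣ r u) = f r := by
  rw [sum_ofQuotientStabilizer_of_invariant r hf, ← cosetCount_eq_card, ← Nat.cast_smul_eq_nsmul ℂ,
    smul_smul, one_div_mul_cancel (cosetCount_ne_zero r), one_smul]

open Classical in
theorem coeff_orbitAverage (r x : KModO K) :
    (orbitAverage r).coeff x =
      if x ∈ MulAction.orbit (𝓞 K)ˣ r then 1 / (cosetCount r : ℂ) else 0 := by
  rw [orbitAverage, AddMonoidAlgebra.coeff_smul_apply, AddMonoidAlgebra.coeff_sum,
    Finsupp.finsetSum_apply]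
  simp only [AddMonoidAlgebra.coeff_single, Finsupp.single_apply]
  rw [sum_ofQuotientStabilizer_ite_eq, smul_ite, smul_zero, smul_eq_mul, mul_one]

theorem coeff_orbitAverage_comm (r x : KModO K) :
    (orbitAverage r).coeff x = (orbitAverage x).coeff r := by
  classical
  rw [coeff_orbitAverage, coeff_orbitAverage, MulAction.mem_orbit_symm]
  split_ifs with h
  · rw [cosetCount_eq_of_mem_orbit h]
  · rfl

theorem orbitAverage_smul (w : (𝓞 K)ˣ) (r : KModO K) : orbitAverage (w • r) = orbitAverage r := by
  classical
  ext x
  rw [coeff_orbitAverage, coeff_orbitAverage, MulAction.orbit_smul,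
    cosetCount_eq_of_mem_orbit (MulAction.mem_orbit r w)]

theorem orbitAverage_zero : orbitAverage (0 : KModO K) = 1 :=
  one_div_cosetCount_smul_sum (f := fun r => AddMonoidAlgebra.single r (1 : ℂ))
    fun w => by rw [smul_zero]

theorem star_orbitAverage (r : KModO K) : star (orbitAverage r) = orbitAverage r := by
  classical
  ext x
  rw [GroupAlg.coeff_star, ← KModO.neg_one_smul, coeff_orbitAverage_comm, orbitAverage_smul,
    coeff_orbitAverage_comm, coeff_orbitAverage]
  split_ifs <;> simp

section LinearExtension

variable {B : Type*} [AddCommGroup B] [Module ℂ B]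

theorem linearExtension_orbitAverage {x : KModO K → B}
    (hx : ∀ (w : (𝓞 K)ˣ) (r : KModO K), x (w • r) = x r) (r : KModO K) :
    linearExtension x (orbitAverage r) = x r := by
  rw [orbitAverage, map_smul, map_sum]
  simp only [linearExtension_single, one_smul]
  exact one_div_cosetCount_smul_sum fun w => hx w r

theorem linearExtension_orbitAverage_mul_orbitAverage (x : KModO K → B) (r s : KModO K) :
    linearExtension x (orbitAverage r * orbitAverage s) =
      ((1 / (cosetCount r : ℂ)) * (1 / (cosetCount s : ℂ))) •
      ∑ u : (𝓞 K)ˣ ⧸ MulAction.stabilizer (𝓞 K)ˣ r, ∑ v : (𝓞 K)ˣ ⧸ MulAction.stabilizer (𝓞 K)ˣ s,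
        x (MulAction.ofQuotientStabilizer (𝓞 K)ˣ r u +
          MulAction.ofQuotientStabilizer (𝓞 K)ˣ s v) := by
  rw [orbitAverage, orbitAverage, smul_mul_smul_comm, map_smul, Finset.sum_mul_sum]
  simp only [map_sum, AddMonoidAlgebra.single_mul_single, linearExtension_single, mul_one, one_smul]

end LinearExtension

theorem linearExtension_orbitAverage_of_invariant {a : AddMonoidAlgebra ℂ (KModO K)}
    (ha : ∀ (w : (𝓞 K)ˣ) (r : KModO K), a.coeff (w • r) = a.coeff r) :
    linearExtension orbitAverage a = a := by
  ext x
  let coeffAt : AddMonoidAlgebra ℂ (KModO K) →ₗ[ℂ] ℂ :=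
    Finsupp.lapply x ∘ₗ (AddMonoidAlgebra.coeffLinearEquiv ℂ).toLinearMap
  calc (linearExtension orbitAverage a).coeff x
      = linearExtension (fun r => (orbitAverage r).coeff x) a := map_linearExtension coeffAt _ _
    _ = linearExtension (orbitAverage x).coeff a := by simp only [coeff_orbitAverage_comm _ x]
    _ = linearExtension a.coeff (orbitAverage x) := linearExtension_coeff_comm _ _
    _ = a.coeff x := linearExtension_orbitAverage ha x

end OrbitAverages

section Restriction

variable {K : Type u} [Field K] [NumberField K]

/-- Restriction of a Hecke function to the translations `(1 y; 0 1)`, as a function of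
`y ∈ K/𝓞`. -/
noncomputable def translRestrict : HeckeK K →ₗ[ℂ] AddMonoidAlgebra ℂ (KModO K) where
  toFun f := .ofCoeff (Finsupp.ofSupportFinite (fun r => f (translCoset r).out)
    (f.isHeckeFun.finite.preimage translCoset_injective.injOn))
  map_add' f f' := AddMonoidAlgebra.ext (Finsupp.ext fun r => by
    rw [AddMonoidAlgebra.coeff_add, Finsupp.add_apply]
    rfl)
  map_smul' c f := AddMonoidAlgebra.ext (Finsupp.ext fun r => by
    rw [RingHom.id_apply, AddMonoidAlgebra.coeff_smul_apply]
    rfl)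

theorem coeff_translRestrict_mk (f : HeckeK K) (y : K) :
    (translRestrict f).coeff (KModO.mk y) = f (transl y) :=
  out_mkRightCoset f.isHeckeFun.left_inv _

theorem coeff_translRestrict_smul (f : HeckeK K) (w : (𝓞 K)ˣ) (r : KModO K) :
    (translRestrict f).coeff (w • r) = (translRestrict f).coeff r := by
  obtain ⟨y, rfl⟩ := KModO.mk_surjective r
  rw [KModO.unit_smul_mk, coeff_translRestrict_mk, coeff_translRestrict_mk,
    ← f.isHeckeFun.left_inv _ (intAff_mem 0 w⁻¹) (transl y),
    ← f.isHeckeFun.right_inv _ (intAff_mem 0 w) (intAff 0 w⁻¹ * transl y)]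
  exact congrArg f.1 (AffGroup.ext (by simp [mul_comm]) (by simp))

theorem linearExtension_orbitAverage_translRestrict (f : HeckeK K) :
    linearExtension orbitAverage (translRestrict f) = translRestrict f :=
  linearExtension_orbitAverage_of_invariant (coeff_translRestrict_smul f)

theorem translRestrict_star (f : HeckeK K) : translRestrict (star f) = star (translRestrict f) := by
  ext r
  obtain ⟨y, rfl⟩ := KModO.mk_surjective r
  rw [GroupAlg.coeff_star, ← map_neg, coeff_translRestrict_mk, coeff_translRestrict_mk,
    HeckeAlgebra.star_apply, transl_inv]

theorem translRestrict_one : translRestrict (1 : HeckeK K) = 1 := by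
  classical
  ext r
  obtain ⟨y, rfl⟩ := KModO.mk_surjective r
  rw [coeff_translRestrict_mk, AddMonoidAlgebra.one_def, AddMonoidAlgebra.coeff_single,
    Finsupp.single_apply]
  refine (HeckeAlgebra.char_one_apply _).trans (if_congr ?_ rfl rfl)
  rw [transl_mem_iff, ← KModO.mk_eq_zero_iff, eq_comm]

open Classical in
theorem theta_apply (r : KModO K) (g : AffGroup K) :
    theta r g =
      if g.x ∈ unitsRange K ∧ KModO.mk g.y ∈ MulAction.orbit (𝓞 K)ˣ r
      then 1 / (cosetCount r : ℂ) else 0 := by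
  obtain ⟨y, rfl⟩ := KModO.mk_surjective r
  change (1 / (cosetCount (KModO.mk y) : ℂ)) *
    (if g ∈ DoubleCoset.doubleCoset (transl y) (intAffGroup K : Set (AffGroup K))
      (intAffGroup K) then 1 else 0) = _
  rw [mul_ite, mul_one, mul_zero, if_congr mem_doubleCoset_transl rfl rfl]

theorem translRestrict_theta (r : KModO K) : translRestrict (theta r) = orbitAverage r := by
  classical
  ext x
  obtain ⟨z, rfl⟩ := KModO.mk_surjective x
  rw [coeff_translRestrict_mk, coeff_orbitAverage, theta_apply, transl_y, transl_x]
  exact if_congr (and_iff_right (one_mem _)) rfl rfl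

variable (K) in
/-- The *-subalgebra of Hecke functions supported on matrices with determinant in `𝓞ˣ`. -/
noncomputable def unitSupported : StarSubalgebra ℂ (HeckeK K) where
  carrier := {f | ∀ g, f g ≠ 0 → g.x ∈ unitsRange K}
  mul_mem' := by
    intro f f' hf hf' g hg
    obtain ⟨q, hq⟩ := not_forall.1 (mt finsum_eq_zero_of_forall_eq_zero hg)
    have hdet := mul_mem (hf _ (left_ne_zero_of_mul hq)) (hf' _ (right_ne_zero_of_mul hq))
    simpa using hdet
  add_mem' := by
    intro f f' hf hf' g hg
    by_cases h : f g = 0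
    · exact hf' g (by simpa [h] using hg)
    · exact hf g h
  algebraMap_mem' := by
    classical
    intro c g hg
    rw [Algebra.algebraMap_eq_smul_one] at hg
    have hone : HeckeAlgebra.char (intAffGroup K) 1 g ≠ 0 := right_ne_zero_of_mul hg
    rw [HeckeAlgebra.char_one_apply] at hone
    obtain ⟨a, u, rfl⟩ := mem_intAffGroup_iff.1 (of_not_not fun h => hone (if_neg h))
    exact ⟨u, rfl⟩
  star_mem' := by
    intro f hf g hg
    have hdet := hf g⁻¹ (by simpa [HeckeAlgebra.star_apply] using hg)
    simpa using hdet

theorem theta_mem_unitSupported (r : KModO K) : theta r ∈ unitSupported K := by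
  classical
  intro g hg
  rw [theta_apply] at hg
  exact (of_not_not fun h => hg (if_neg h)).1

theorem eq_zero_of_translRestrict_eq_zero {f : HeckeK K} (hf : f ∈ unitSupported K)
    (h : translRestrict f = 0) : f = 0 := by
  refine HeckeAlgebra.ext fun g => by_contra fun hg => hg ?_
  obtain ⟨u, hu⟩ := exists_eq_intAff_mul_transl (hf g hg)
  rw [hu, f.isHeckeFun.left_inv _ (intAff_mem 0 u), ← coeff_translRestrict_mk, h]
  rfl

theorem translRestrict_injOn : Set.InjOn (translRestrict (K := K)) (unitSupported K) :=
  fun _ hf _ hf' h => sub_eq_zero.1 <|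
    eq_zero_of_translRestrict_eq_zero (sub_mem hf hf') (by rw [map_sub, h, sub_self])

theorem heckeConv_summand_translCoset (f f' : HeckeK K) (y : K) (s : KModO K) :
    f (transl y * (translCoset s).out⁻¹) * f' (translCoset s).out =
      (translRestrict f).coeff (KModO.mk y + -s) * (translRestrict f').coeff s := by
  obtain ⟨z, rfl⟩ := KModO.mk_surjective s
  rw [← map_neg, ← map_add, coeff_translRestrict_mk, coeff_translRestrict_mk, ← sub_eq_add_neg,
    ← transl_mul_transl_inv]
  exact out_mkRightCoset (F := fun g => f (transl y * g⁻¹) * f' g)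
    (heckeConv_summand_inv f.isHeckeFun.right_inv f'.isHeckeFun.left_inv _) _

theorem exists_translCoset_eq {f : HeckeK K} (hf : f ∈ unitSupported K)
    {q : RightCosets (intAffGroup K)} (hq : f q.out ≠ 0) : ∃ s, translCoset s = q :=
  ⟨_, (translCoset_mk_eq_mkRightCoset (hf _ hq)).trans q.out_eq⟩

theorem translRestrict_mul (f : HeckeK K) {f' : HeckeK K} (hf' : f' ∈ unitSupported K) :
    translRestrict (f * f') = translRestrict f * translRestrict f' := by
  ext r
  obtain ⟨y, rfl⟩ := KModO.mk_surjective r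
  rw [coeff_translRestrict_mk, AddMonoidAlgebra.coeff_mul_apply_right, Finsupp.sum,
    HeckeAlgebra.mul_apply, heckeConv, finsum_eq_sum_of_support_subset
      (s := (translRestrict f').coeff.support.map ⟨translCoset, translCoset_injective⟩),
    Finset.sum_map]
  · exact Finset.sum_congr rfl fun s _ => heckeConv_summand_translCoset f f' y s
  · intro q hq
    obtain ⟨s, rfl⟩ := exists_translCoset_eq hf' (right_ne_zero_of_mul hq)
    rw [Function.mem_support, heckeConv_summand_translCoset] at hq
    exact Finset.mem_map_of_mem _ (Finsupp.mem_support_iff.2 (right_ne_zero_of_mul hq))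

theorem linearExtension_theta_translRestrict {f : HeckeK K} (hf : f ∈ unitSupported K) :
    linearExtension theta (translRestrict f) = f := by
  have hspan : Submodule.span ℂ (Set.range (theta (K := K))) ≤
      (unitSupported K).toSubalgebra.toSubmodule :=
    Submodule.span_le.2 (Set.range_subset_iff.2 theta_mem_unitSupported)
  refine translRestrict_injOn (hspan (linearExtension_mem_span theta _)) hf ?_
  rw [map_linearExtension]
  simp only [translRestrict_theta]
  exact linearExtension_orbitAverage_translRestrict f

theorem thetaRelations_theta : ThetaRelations (theta (K := K)) where
  zero := translRestrict_injOn (theta_mem_unitSupported _) (one_mem _) <| by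
    rw [translRestrict_theta, translRestrict_one, orbitAverage_zero]
  unit_smul w r :=
    translRestrict_injOn (theta_mem_unitSupported _) (theta_mem_unitSupported _) <| by
      rw [translRestrict_theta, translRestrict_theta, orbitAverage_smul]
  star_eq r :=
    translRestrict_injOn (star_mem (theta_mem_unitSupported _)) (theta_mem_unitSupported _) <| by
      rw [translRestrict_star, translRestrict_theta, star_orbitAverage]
  mul_eq r s := by
    rw [← linearExtension_orbitAverage_mul_orbitAverage, ← translRestrict_theta,
      ← translRestrict_theta, ← translRestrict_mul _ (theta_mem_unitSupported _),
      linearExtension_theta_translRestrict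
        (mul_mem (theta_mem_unitSupported _) (theta_mem_unitSupported _))]

theorem thetaAlg_le_unitSupported : thetaAlg K ≤ unitSupported K :=
  StarAlgebra.adjoin_le (Set.range_subset_iff.2 theta_mem_unitSupported)

/-- Restriction to translations as a *-homomorphism on `𝔄`. -/
noncomputable def thetaRestrict : thetaAlg K →⋆ₐ[ℂ] AddMonoidAlgebra ℂ (KModO K) where
  toAlgHom := AlgHom.ofLinearMap (translRestrict ∘ₗ (thetaAlg K).subtype.toAlgHom.toLinearMap)
    translRestrict_one fun f g => translRestrict_mul f.1 (thetaAlg_le_unitSupported g.2)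
  map_star' f := translRestrict_star f.1

theorem thetaRestrict_apply (f : thetaAlg K) : thetaRestrict f = translRestrict f.1 := rfl

theorem thetaRestrict_thetaGen (r : KModO K) : thetaRestrict (thetaGen r) = orbitAverage r :=
  translRestrict_theta r

theorem thetaRestrict_injective : Function.Injective (thetaRestrict (K := K)) := fun f g h =>
  Subtype.ext <|
    translRestrict_injOn (thetaAlg_le_unitSupported f.2) (thetaAlg_le_unitSupported g.2) h

theorem thetaAlg_mul_comm (f g : thetaAlg K) : f * g = g * f :=
  thetaRestrict_injective (by rw [map_mul, map_mul, mul_comm])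

end Restriction

section Relations

variable {K : Type u} [Field K] [NumberField K]
variable {B : Type*} [Ring B] [StarRing B] [Algebra ℂ B] {x : KModO K → B}

namespace ThetaRelations

theorem map {C : Type*} [Ring C] [StarRing C] [Algebra ℂ C] (hx : ThetaRelations x)
    (φ : B →⋆ₐ[ℂ] C) : ThetaRelations fun r => φ (x r) where
  zero := by rw [hx.zero, map_one]
  unit_smul w r := by rw [hx.unit_smul]
  star_eq r := by rw [← map_star, hx.star_eq]
  mul_eq r s := by
    rw [← map_mul, hx.mul_eq, map_smul]
    simp only [map_sum]

theorem of_injective {C : Type*} [Ring C] [StarRing C] [Algebra ℂ C] {φ : B →⋆ₐ[ℂ] C}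
    (hφ : Function.Injective φ) (hx : ThetaRelations fun r => φ (x r)) : ThetaRelations x where
  zero := hφ (by rw [hx.zero, map_one])
  unit_smul w r := hφ (hx.unit_smul w r)
  star_eq r := hφ (by rw [map_star, hx.star_eq])
  mul_eq r s := hφ (by
    rw [map_mul, hx.mul_eq, map_smul]
    simp only [map_sum])

theorem neg (hx : ThetaRelations x) (r : KModO K) : x (-r) = x r := by
  rw [← KModO.neg_one_smul, hx.unit_smul]

theorem linearExtension_one (hx : ThetaRelations x) : linearExtension (R := ℂ) x 1 = 1 := by
  rw [AddMonoidAlgebra.one_def, linearExtension_single, one_smul, hx.zero]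

theorem linearExtension_average_mul_average (hx : ThetaRelations x)
    (a b : AddMonoidAlgebra ℂ (KModO K)) :
    linearExtension x (linearExtension orbitAverage a * linearExtension orbitAverage b) =
      linearExtension x a * linearExtension x b := by
  induction a using AddMonoidAlgebra.induction_linear with
  | zero => simp
  | add a a' h h' => simp only [map_add, add_mul, h, h']
  | single r c =>
    induction b using AddMonoidAlgebra.induction_linear with
    | zero => simp
    | add b b' h h' => simp only [map_add, mul_add, h, h']
    | single s d =>
      simp only [linearExtension_single, smul_mul_smul_comm]
      rw [map_smul, linearExtension_orbitAverage_mul_orbitAverage, ← hx.mul_eq]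

theorem linearExtension_star [StarModule ℂ B] (hx : ThetaRelations x)
    (a : AddMonoidAlgebra ℂ (KModO K)) :
    linearExtension x (star a) = star (linearExtension x a) := by
  induction a using AddMonoidAlgebra.induction_linear with
  | zero => simp
  | add a a' h h' => simp only [map_add, star_add, h, h']
  | single r c =>
    rw [GroupAlg.star_single, linearExtension_single, linearExtension_single, hx.neg, star_smul,
      hx.star_eq, starRingEnd_apply]

theorem linearExtension_thetaRestrict_mul (hx : ThetaRelations x) (f g : thetaAlg K) :
    linearExtension x (thetaRestrict (f * g)) =
      linearExtension x (thetaRestrict f) * linearExtension x (thetaRestrict g) := by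
  rw [map_mul, ← hx.linearExtension_average_mul_average, thetaRestrict_apply, thetaRestrict_apply,
    linearExtension_orbitAverage_translRestrict, linearExtension_orbitAverage_translRestrict]

end ThetaRelations

/-- The *-homomorphism `𝔄 → B`, `θ_r ↦ x_r`, defined by a family satisfying the relations (II). -/
noncomputable def thetaLift [StarModule ℂ B] (hx : ThetaRelations x) : thetaAlg K →⋆ₐ[ℂ] B where
  toAlgHom := AlgHom.ofLinearMap (linearExtension x ∘ₗ thetaRestrict.toAlgHom.toLinearMap)
    ((congrArg (linearExtension x) (map_one thetaRestrict)).trans hx.linearExtension_one)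
    hx.linearExtension_thetaRestrict_mul
  map_star' f := (congrArg (linearExtension x) (map_star thetaRestrict f)).trans
    (hx.linearExtension_star _)

theorem thetaLift_thetaGen [StarModule ℂ B] (hx : ThetaRelations x) (r : KModO K) :
    thetaLift hx (thetaGen r) = x r :=
  (congrArg (linearExtension x) (thetaRestrict_thetaGen r)).trans
    (linearExtension_orbitAverage hx.unit_smul r)

theorem thetaRelations_thetaGen : ThetaRelations (thetaGen (K := K)) :=
  .of_injective (φ := (thetaAlg K).subtype) Subtype.val_injective thetaRelations_theta

theorem linearExtension_thetaGen (f : thetaAlg K) :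
    linearExtension thetaGen (thetaRestrict f) = f :=
  Subtype.ext <| (map_linearExtension (thetaAlg K).subtype.toAlgHom.toLinearMap thetaGen _).trans
    (linearExtension_theta_translRestrict (thetaAlg_le_unitSupported f.2))

theorem span_range_thetaGen : Submodule.span ℂ (Set.range (thetaGen (K := K))) = ⊤ :=
  Submodule.eq_top_iff'.2 fun f => linearExtension_thetaGen f ▸ linearExtension_mem_span thetaGen _

theorem thetaAlg_hom_ext {φ ψ : thetaAlg K →⋆ₐ[ℂ] B}
    (h : ∀ r, φ (thetaGen r) = ψ (thetaGen r)) : φ = ψ := by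
  have hlin : φ.toAlgHom.toLinearMap = ψ.toAlgHom.toLinearMap :=
    LinearMap.ext_on_range span_range_thetaGen h
  exact StarAlgHom.ext (LinearMap.congr_fun hlin)

theorem existsUnique_thetaAlg_hom [StarModule ℂ B] (hx : ThetaRelations x) :
    ∃! φ : thetaAlg K →⋆ₐ[ℂ] B, ∀ r, φ (thetaGen r) = x r :=
  ⟨thetaLift hx, thetaLift_thetaGen hx, fun φ h => thetaAlg_hom_ext fun r => by
    rw [h, thetaLift_thetaGen]⟩

theorem thetaRelations_orbitAverage : ThetaRelations (orbitAverage (K := K)) := by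
  simpa only [thetaRestrict_thetaGen] using thetaRelations_thetaGen.map (thetaRestrict (K := K))

end Relations

section Basis

variable {K : Type u} [Field K] [NumberField K]

/-- The family `θ_r`, indexed by the `𝓞ˣ`-orbits in `K/𝓞`. -/
noncomputable def thetaOrbit (q : MulAction.orbitRel.Quotient (𝓞 K)ˣ (KModO K)) : thetaAlg K :=
  Quotient.liftOn' q thetaGen <| by
    rintro _ r ⟨w, rfl⟩
    exact thetaRelations_thetaGen.unit_smul w r

theorem thetaOrbit_mk (r : KModO K) : thetaOrbit (Quotient.mk'' r) = thetaGen r := rfl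

theorem span_range_thetaOrbit : Submodule.span ℂ (Set.range (thetaOrbit (K := K))) = ⊤ := by
  rw [← span_range_thetaGen, ← Quotient.mk''_surjective.range_comp]
  rfl

/-- The linear functional on `𝔄` dual to `θ_r`: the coefficient of the restriction to translations
at `r`, normalized by the size `R(r)` of the orbit. -/
noncomputable def orbitCoeff (r : KModO K) : Module.Dual ℂ (thetaAlg K) :=
  (cosetCount r : ℂ) • Finsupp.lapply r ∘ₗ (AddMonoidAlgebra.coeffLinearEquiv ℂ).toLinearMap ∘ₗ
    thetaRestrict.toAlgHom.toLinearMap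

open Classical in
theorem orbitCoeff_thetaGen (r s : KModO K) :
    orbitCoeff r (thetaGen s) = if s ∈ MulAction.orbit (𝓞 K)ˣ r then 1 else 0 := by
  change (cosetCount r : ℂ) * (thetaRestrict (thetaGen s)).coeff r = _
  rw [thetaRestrict_thetaGen, coeff_orbitAverage_comm, coeff_orbitAverage, mul_ite, mul_zero,
    mul_one_div_cancel (cosetCount_ne_zero r)]

open Classical in
theorem orbitCoeff_out_thetaOrbit (p q : MulAction.orbitRel.Quotient (𝓞 K)ˣ (KModO K)) :
    orbitCoeff p.out (thetaOrbit q) = if p = q then 1 else 0 := by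
  obtain ⟨s, rfl⟩ := Quotient.mk''_surjective q
  rw [thetaOrbit_mk, orbitCoeff_thetaGen]
  refine if_congr ?_ rfl rfl
  rw [← MulAction.orbitRel_apply, ← Quotient.eq'', Quotient.out_eq', eq_comm]

theorem linearIndependent_thetaOrbit : LinearIndependent ℂ (thetaOrbit (K := K)) := by
  classical
  exact .of_pairwise_dual_eq_zero_one _ (fun p => orbitCoeff p.out)
    (fun p q hpq => (orbitCoeff_out_thetaOrbit p q).trans (if_neg hpq))
    fun p => (orbitCoeff_out_thetaOrbit p p).trans (if_pos rfl)

variable (K) in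
theorem exists_basis_thetaGen :
    ∃ b : Module.Basis (MulAction.orbitRel.Quotient (𝓞 K)ˣ (KModO K)) ℂ (thetaAlg K),
      ∀ r : KModO K, b (Quotient.mk'' r) = thetaGen r :=
  ⟨.mk linearIndependent_thetaOrbit span_range_thetaOrbit.ge, fun r => by
    rw [Module.Basis.mk_apply, thetaOrbit_mk]⟩

end Basis

section Levels

variable {K : Type u} [Field K]

theorem KModO.smul_mk_eq_zero_iff {d : 𝓞 K} {y : K} :
    d • KModO.mk y = 0 ↔ ∃ a : 𝓞 K, (a : K) = y * d := by
  rw [← map_smul, KModO.mk_eq_zero_iff, Algebra.smul_def, mul_comm]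

theorem smul_ofQuotientStabilizer_eq_zero {d : 𝓞 K} {r : KModO K} (hr : d • r = 0)
    (u : (𝓞 K)ˣ ⧸ MulAction.stabilizer (𝓞 K)ˣ r) :
    d • MulAction.ofQuotientStabilizer (𝓞 K)ˣ r u = 0 := by
  obtain ⟨w, hw⟩ := MulAction.ofQuotientStabilizer_mem_orbit (𝓞 K)ˣ r u
  rw [← hw]
  change d • w • r = 0
  rw [smul_comm, hr, smul_zero]

variable [NumberField K]

theorem finite_torsion {d : 𝓞 K} (hd : d ≠ 0) : {r : KModO K | d • r = 0}.Finite := by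
  have hd' : (d : K) ≠ 0 := by simpa using hd
  refine (finite_range_of_mod (fun p : 𝓞 K × (𝓞 K)ˣ => KModO.mk ((p.1 : K) / d)) hd ?_).subset ?_
  · rintro a u b v ⟨t, ht⟩ -
    rw [eq_comm, KModO.mk_eq_iff]
    refine ⟨t, ?_⟩
    rw [← sub_div, ← map_sub, ht, map_mul, mul_div_cancel_left₀ _ hd']
  · intro r hr
    obtain ⟨y, rfl⟩ := KModO.mk_surjective r
    obtain ⟨a, ha⟩ := KModO.smul_mk_eq_zero_iff.1 hr
    exact ⟨(a, 1), by simp only [ha, mul_div_cancel_right₀ _ hd']⟩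

theorem thetaSpan_eq_span_image_torsion (d : 𝓞 K) :
    thetaSpan d = Submodule.span ℂ (theta '' {r : KModO K | d • r = 0}) := by
  refine congrArg (Submodule.span ℂ) (Set.Subset.antisymm ?_ ?_)
  · rintro _ ⟨y, hy, rfl⟩
    exact ⟨_, KModO.smul_mk_eq_zero_iff.2 hy, rfl⟩
  · rintro _ ⟨r, hr, rfl⟩
    obtain ⟨y, rfl⟩ := KModO.mk_surjective r
    exact ⟨y, KModO.smul_mk_eq_zero_iff.1 hr, rfl⟩

theorem theta_mem_thetaSpan {d : 𝓞 K} {r : KModO K} (h : d • r = 0) : theta r ∈ thetaSpan d := by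
  rw [thetaSpan_eq_span_image_torsion]
  exact Submodule.subset_span ⟨r, h, rfl⟩

theorem finiteDimensional_thetaSpan {d : 𝓞 K} (hd : d ≠ 0) :
    FiniteDimensional ℂ (thetaSpan d) := by
  rw [thetaSpan_eq_span_image_torsion]
  exact FiniteDimensional.span_of_finite ℂ ((finite_torsion hd).image _)

theorem thetaSpan_le_iff {d : 𝓞 K} {M : Submodule ℂ (HeckeK K)} :
    thetaSpan d ≤ M ↔ ∀ r : KModO K, d • r = 0 → theta r ∈ M := by
  rw [thetaSpan_eq_span_image_torsion, Submodule.span_le, Set.image_subset_iff]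
  rfl

theorem thetaSpan_mul_thetaSpan_le (d : 𝓞 K) : thetaSpan d * thetaSpan d ≤ thetaSpan d := by
  conv_lhs => rw [thetaSpan_eq_span_image_torsion, Submodule.span_mul_span]
  refine Submodule.span_le.2 ?_
  rintro _ ⟨_, ⟨r, hr, rfl⟩, _, ⟨s, hs, rfl⟩, rfl⟩
  change theta r * theta s ∈ thetaSpan d
  rw [thetaRelations_theta.mul_eq]
  refine Submodule.smul_mem _ _ (sum_mem fun u _ => sum_mem fun v _ => theta_mem_thetaSpan ?_)
  rw [smul_add, smul_ofQuotientStabilizer_eq_zero hr, smul_ofQuotientStabilizer_eq_zero hs,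
    add_zero]

theorem star_mem_thetaSpan {d : 𝓞 K} {f : HeckeK K} (hf : f ∈ thetaSpan d) :
    star f ∈ thetaSpan d := by
  rw [thetaSpan_eq_span_image_torsion] at hf
  induction hf using Submodule.span_induction with
  | mem f hf =>
    obtain ⟨r, hr, rfl⟩ := hf
    rw [thetaRelations_theta.star_eq]
    exact theta_mem_thetaSpan hr
  | zero => simp only [star_zero, zero_mem]
  | add f g _ _ hf hg => simpa only [star_add] using add_mem hf hg
  | smul c f _ hf => simpa only [star_smul] using Submodule.smul_mem _ _ hf

/-- The space `𝔄(d)` as a *-subalgebra of the Hecke algebra. -/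
noncomputable def thetaSpanAlg (d : 𝓞 K) : StarSubalgebra ℂ (HeckeK K) where
  carrier := thetaSpan d
  add_mem' := add_mem
  mul_mem' hf hg := thetaSpan_mul_thetaSpan_le d (Submodule.mul_mem_mul hf hg)
  algebraMap_mem' c := by
    rw [Algebra.algebraMap_eq_smul_one, ← thetaRelations_theta.zero]
    exact Submodule.smul_mem _ _ (theta_mem_thetaSpan (smul_zero d))
  star_mem' := star_mem_thetaSpan

theorem thetaSpanAlg_toSubmodule (d : 𝓞 K) :
    (thetaSpanAlg d).toSubalgebra.toSubmodule = thetaSpan d := rfl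

theorem thetaSpanAlg_le_thetaAlg (d : 𝓞 K) : thetaSpanAlg d ≤ thetaAlg K := by
  have h : thetaSpan d ≤ (thetaAlg K).toSubalgebra.toSubmodule :=
    thetaSpan_le_iff.2 fun r _ => (thetaGen r).2
  exact h

theorem thetaSpan_mono {d e : 𝓞 K} (h : d ∣ e) : thetaSpan d ≤ thetaSpan e := by
  obtain ⟨c, rfl⟩ := h
  refine thetaSpan_le_iff.2 fun r hr => theta_mem_thetaSpan ?_
  rw [mul_comm, mul_smul, hr, smul_zero]

theorem exists_mem_thetaSpan {f : HeckeK K} (hf : f ∈ thetaAlg K) :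
    ∃ d : 𝓞 K, d ≠ 0 ∧ f ∈ thetaSpan d := by
  rw [← linearExtension_theta_translRestrict (thetaAlg_le_unitSupported hf)]
  induction translRestrict f using AddMonoidAlgebra.induction_linear with
  | zero => exact ⟨1, one_ne_zero, by simp only [map_zero, zero_mem]⟩
  | add a b ha hb =>
    obtain ⟨d, hd, hda⟩ := ha
    obtain ⟨e, he, heb⟩ := hb
    refine ⟨d * e, mul_ne_zero hd he, ?_⟩
    rw [map_add]
    exact add_mem (thetaSpan_mono (dvd_mul_right d e) hda) (thetaSpan_mono (dvd_mul_left e d) heb)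
  | single r c =>
    obtain ⟨y, rfl⟩ := KModO.mk_surjective r
    obtain ⟨n, hn, a, ha⟩ := exists_denom y
    refine ⟨n, hn, ?_⟩
    rw [linearExtension_single]
    exact Submodule.smul_mem _ _ (theta_mem_thetaSpan
      (KModO.smul_mk_eq_zero_iff.2 ⟨a, by rw [ha, mul_comm]⟩))

theorem coe_thetaAlg_eq_iUnion :
    (thetaAlg K : Set (HeckeK K)) = ⋃ d ∈ {d : 𝓞 K | d ≠ 0}, (thetaSpan d : Set (HeckeK K)) := by
  ext f
  simp only [Set.mem_iUnion]
  constructor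
  · intro hf
    obtain ⟨d, hd, h⟩ := exists_mem_thetaSpan hf
    exact ⟨d, hd, h⟩
  · rintro ⟨d, -, h⟩
    exact thetaSpanAlg_le_thetaAlg d h

end Levels

section CStar

open scoped CStarAlgebra

variable {A B C : Type*} [Ring A] [StarRing A] [Algebra ℂ A] [CStarAlgebra B] [CStarAlgebra C]

theorem norm_starAlgHom_apply_le_of_finiteDimensional [FiniteDimensional ℂ A] {f : A →⋆ₐ[ℂ] C}
    (hf : Function.Injective f) (g : A →⋆ₐ[ℂ] B) (a : A) : ‖g a‖ ≤ ‖f a‖ := by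
  have : FiniteDimensional ℂ f.range.toSubalgebra.toSubmodule :=
    (LinearEquiv.ofInjective f.toAlgHom.toLinearMap hf).finiteDimensional
  have : IsClosed (f.range : Set C) :=
    Submodule.closed_of_finiteDimensional f.range.toSubalgebra.toSubmodule
  let e : A ≃⋆ₐ[ℂ] f.range := StarAlgEquiv.ofInjective f hf
  let h : f.range →⋆ₐ[ℂ] B := g.comp (e.symm : f.range →⋆ₐ[ℂ] A)
  calc ‖g a‖ = ‖h (e a)‖ := congrArg (fun b => ‖g b‖) (e.symm_apply_apply a).symm
    _ ≤ ‖e a‖ := NonUnitalStarAlgHom.norm_apply_le h (e a)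
    _ = ‖f a‖ := rfl

section DenseRange

variable {j : A →⋆ₐ[ℂ] C} (hj : DenseRange j)
include hj

theorem exists_starAlgHom_comp_eq {g : A →⋆ₐ[ℂ] B} (hg : ∀ a, ‖g a‖ ≤ ‖j a‖) :
    ∃ ψ : C →⋆ₐ[ℂ] B, ψ.comp j = g := by
  let ψ : C →L[ℂ] B := g.toAlgHom.toLinearMap.extendOfNorm j.toAlgHom.toLinearMap
  have hψ : ∀ a, ψ (j a) = g a :=
    LinearMap.extendOfNorm_eq hj ⟨1, fun a => (hg a).trans_eq (one_mul _).symm⟩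
  have hone : ψ 1 = 1 := by rw [← map_one j, hψ, map_one]
  have hmul (x y : C) : ψ (x * y) = ψ x * ψ y := by
    refine hj.induction_on₂ (p := fun x y => ψ (x * y) = ψ x * ψ y) ?_ (fun a b => ?_) x y
    · exact isClosed_eq (by fun_prop) (by fun_prop)
    · rw [← map_mul, hψ, hψ, hψ, map_mul]
  have hstar (x : C) : ψ (star x) = star (ψ x) := by
    refine hj.induction_on (p := fun x => ψ (star x) = star (ψ x)) x ?_ fun a => ?_
    · exact isClosed_eq (by fun_prop) (by fun_prop)
    · rw [← map_star, hψ, hψ, map_star]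
  exact ⟨⟨AlgHom.ofLinearMap ψ.toLinearMap hone hmul, hstar⟩, StarAlgHom.ext hψ⟩

theorem starAlgHom_ext_of_denseRange {φ ψ : C →⋆ₐ[ℂ] B} (h : φ.comp j = ψ.comp j) : φ = ψ :=
  DFunLike.coe_injective <|
    hj.equalizer (map_continuous φ) (map_continuous ψ) (congrArg DFunLike.coe h)

end DenseRange

/-- A *-algebra is locally finite-dimensional if each of its elements lies in a finite-dimensional
*-subalgebra. Such an algebra carries at most one C*-norm, whether or not it is complete. -/
def IsLocallyFiniteDimensional (A : Type*) [Ring A] [StarRing A] [Algebra ℂ A] [StarModule ℂ A] :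
    Prop :=
  ∀ a : A, ∃ S : StarSubalgebra ℂ A, FiniteDimensional ℂ S ∧ a ∈ S

namespace IsLocallyFiniteDimensional

variable [StarModule ℂ A] (hA : IsLocallyFiniteDimensional A) {j : A →⋆ₐ[ℂ] C}
include hA

theorem norm_starAlgHom_apply_le (hj : Function.Injective j) (g : A →⋆ₐ[ℂ] B) (a : A) :
    ‖g a‖ ≤ ‖j a‖ := by
  obtain ⟨S, _, ha⟩ := hA a
  exact norm_starAlgHom_apply_le_of_finiteDimensional (f := j.comp S.subtype)
    (hj.comp Subtype.val_injective) (g.comp S.subtype) ⟨a, ha⟩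

theorem existsUnique_comp_eq (hj : Function.Injective j) (hj' : DenseRange j) (g : A →⋆ₐ[ℂ] B) :
    ∃! ψ : C →⋆ₐ[ℂ] B, ψ.comp j = g := by
  obtain ⟨ψ, hψ⟩ := exists_starAlgHom_comp_eq hj' (hA.norm_starAlgHom_apply_le hj g)
  exact ⟨ψ, hψ, fun φ hφ => starAlgHom_ext_of_denseRange hj' (hφ.trans hψ.symm)⟩

theorem isometry_of_injective_comp (hj : DenseRange j) {ψ : C →⋆ₐ[ℂ] B}
    (hψ : Function.Injective (ψ.comp j)) : Isometry ψ := by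
  refine AddMonoidHomClass.isometry_of_norm ψ fun c => ?_
  have hclosed : IsClosed {c | ‖ψ c‖ = ‖c‖} :=
    isClosed_eq (map_continuous ψ).norm continuous_norm
  exact hj.induction_on c hclosed fun a => le_antisymm
    (NonUnitalStarAlgHom.norm_apply_le ψ (j a)) (hA.norm_starAlgHom_apply_le hψ j a)

end IsLocallyFiniteDimensional

end CStar

section GroupAlgebra

variable {D : Type u} [AddCommGroup D]

/-- The C*-seminorm `a ↦ ‖φ a‖` on the group algebra defined by a representation `φ` in a
C*-algebra. -/
noncomputable def CStarSeminorm.ofStarAlgHom {B : Type*} [CStarAlgebra B]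
    (φ : AddMonoidAlgebra ℂ D →⋆ₐ[ℂ] B) : CStarSeminorm D :=
  ⟨(normSeminorm ℂ B).comp φ.toAlgHom.toLinearMap,
    fun a b => (congrArg norm (map_mul φ a b)).trans_le (norm_mul_le _ _), fun a => by
      change ‖φ (star a * a)‖ = ‖φ a‖ ^ 2
      rw [map_mul, map_star, CStarRing.norm_star_mul_self, sq]⟩

theorem norm_apply_le_maxCStarNorm {B : Type*} [CStarAlgebra B]
    (φ : AddMonoidAlgebra ℂ D →⋆ₐ[ℂ] B) (a : AddMonoidAlgebra ℂ D) : ‖φ a‖ ≤ maxCStarNorm a :=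
  le_maxCStarNorm (CStarSeminorm.ofStarAlgHom φ) a

/-- The inclusion `ℚ/ℤ → ℝ/ℤ`. -/
noncomputable def ratCircleToReal : AddCircle (1 : ℚ) →+ AddCircle (1 : ℝ) :=
  QuotientAddGroup.map _ _ (Rat.castHom ℝ).toAddMonoidHom (by
    intro x hx
    obtain ⟨n, rfl⟩ := AddSubgroup.mem_zmultiples_iff.1 hx
    exact AddSubgroup.mem_zmultiples_iff.2 ⟨n, by simp⟩)

theorem ratCircleToReal_injective : Function.Injective ratCircleToReal := by
  refine (injective_iff_map_eq_zero _).2 fun x hx => ?_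
  obtain ⟨q, rfl⟩ := QuotientAddGroup.mk_surjective x
  have hq : ((q : ℝ) : AddCircle (1 : ℝ)) = 0 := hx
  obtain ⟨n, hn⟩ := (AddCircle.coe_eq_zero_iff _).1 hq
  refine (AddCircle.coe_eq_zero_iff _).2 ⟨n, ?_⟩
  rw [zsmul_one] at hn ⊢
  exact_mod_cast hn

theorem exists_addChar_circle_ne_one {d : D} (hd : d ≠ 0) : ∃ χ : AddChar D Circle, χ d ≠ 1 := by
  obtain ⟨c, hc⟩ := CharacterModule.exists_character_apply_ne_zero_of_ne_zero hd
  refine ⟨(AddCircle.toCircle_addChar (T := 1)).compAddMonoidHom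
    (ratCircleToReal.comp c), fun h => hc ?_⟩
  refine ratCircleToReal_injective (AddCircle.injective_toCircle one_ne_zero ?_)
  rw [map_zero, AddCircle.toCircle_zero]
  exact h

theorem lift_addChar_star (χ : AddChar D Circle) (a : AddMonoidAlgebra ℂ D) :
    AddMonoidAlgebra.lift ℂ ℂ D (Circle.coeHom.comp χ.toMonoidHom) (star a) =
      star (AddMonoidAlgebra.lift ℂ ℂ D (Circle.coeHom.comp χ.toMonoidHom) a) := by
  induction a using AddMonoidAlgebra.induction_linear with
  | zero => simp
  | add a b ha hb => simp only [star_add, map_add, ha, hb]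
  | single d c =>
    have hχ : (χ (-d) : ℂ) = star (χ d : ℂ) := by
      rw [AddChar.map_neg_eq_inv, Circle.coe_inv_eq_conj, starRingEnd_apply]
    rw [GroupAlg.star_single, AddMonoidAlgebra.lift_single, AddMonoidAlgebra.lift_single,
      star_smul]
    exact congrArg (star c • ·) hχ

/-- Evaluation of the group algebra at a unitary character. -/
noncomputable def characterEval (χ : AddChar D Circle) : AddMonoidAlgebra ℂ D →⋆ₐ[ℂ] ℂ where
  toAlgHom := AddMonoidAlgebra.lift ℂ ℂ D (Circle.coeHom.comp χ.toMonoidHom)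
  map_star' := lift_addChar_star χ

theorem characterEval_single (χ : AddChar D Circle) (d : D) (c : ℂ) :
    characterEval χ (AddMonoidAlgebra.single d c) = c * χ d :=
  AddMonoidAlgebra.lift_single _ _ _

variable (D) in
theorem linearIndependent_characterValue :
    LinearIndependent ℂ fun (d : D) (χ : AddChar D Circle) => (χ d : ℂ) := by
  let ev (d : D) : AddChar D Circle →* ℂ :=
    { toFun := fun χ => χ d
      map_one' := rfl
      map_mul' := fun _ _ => rfl }
  have hev : Function.Injective ev := fun d e h => by
    by_contra hde
    obtain ⟨χ, hχ⟩ := exists_addChar_circle_ne_one (sub_ne_zero.2 hde)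
    have hval : χ d = χ e := Circle.coe_injective (DFunLike.congr_fun h χ)
    exact hχ (by rw [AddChar.map_sub_eq_div, hval, div_self'])
  exact (linearIndependent_monoidHom (AddChar D Circle) ℂ).comp ev hev

theorem linearCombination_characterValue (a : AddMonoidAlgebra ℂ D) (χ : AddChar D Circle) :
    Finsupp.linearCombination ℂ (fun (d : D) (χ : AddChar D Circle) => (χ d : ℂ)) a.coeff χ =
      characterEval χ a := by
  induction a using AddMonoidAlgebra.induction_linear with
  | zero => simp
  | add a b ha hb => rw [AddMonoidAlgebra.coeff_add, map_add, Pi.add_apply, ha, hb, map_add]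
  | single d c => rw [characterEval_single, AddMonoidAlgebra.coeff_single]; simp

theorem eq_zero_of_forall_characterEval_eq_zero {a : AddMonoidAlgebra ℂ D}
    (h : ∀ χ, characterEval χ a = 0) : a = 0 :=
  AddMonoidAlgebra.coeff_eq_zero.1 <| linearIndependent_iff.1 (linearIndependent_characterValue D)
    a.coeff <| funext fun χ => (linearCombination_characterValue a χ).trans (h χ)

theorem GroupCStar.ofGroupAlg_injective : Function.Injective (GroupCStar.ofGroupAlg D) := by
  refine (injective_iff_map_eq_zero _).2 fun a ha =>
    eq_zero_of_forall_characterEval_eq_zero fun χ => norm_le_zero_iff.1 ?_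
  have h : maxCStarNorm a = 0 :=
    (GroupCStar.norm_ofPre (D := D) a).symm.trans ((congrArg norm ha).trans norm_zero)
  exact h ▸ norm_apply_le_maxCStarNorm (characterEval χ) a

end GroupAlgebra

section HeckeRepresentation

-- `λ(f)` maps the point mass at the coset of `1` to `f`.
theorem heckeRep_injective {G : Type u} [Group G] {Γ : Subgroup G} [IsHeckePair Γ] :
    Function.Injective (heckeRep Γ) := by
  classical
  refine (injective_iff_map_eq_zero _).2 fun f hf => HeckeAlgebra.ext fun g => ?_
  have hop : heckeOp f = 0 := hf
  have hout : mkRightCoset Γ (mkRightCoset Γ (1 : G)).out = mkRightCoset Γ 1 := Quotient.out_eq _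
  rw [mkRightCoset_eq_iff, one_mul] at hout
  have hval := heckeOp_single f (mkRightCoset Γ 1) (mkRightCoset Γ g) 1
  rw [hop, f.isHeckeFun.right_inv _ hout, out_mkRightCoset f.isHeckeFun.left_inv, mul_one] at hval
  exact hval.symm

variable {K : Type u} [Field K] [NumberField K]

/-- The restriction of the Hecke representation to `𝔄`, as a map into `A_θ`. -/
noncomputable def thetaRep : thetaAlg K →⋆ₐ[ℂ] thetaCStar K :=
  StarAlgHom.codRestrict ((heckeRep (intAffGroup K)).comp (thetaAlg K).subtype) (thetaCStar K)
    fun f => StarSubalgebra.le_topologicalClosure _ ⟨f, f.2, rfl⟩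

theorem thetaRep_thetaGen (r : KModO K) : thetaRep (thetaGen r) = thetaCStarGen r := rfl

theorem thetaRep_injective : Function.Injective (thetaRep (K := K)) := fun _ _ h =>
  Subtype.ext (heckeRep_injective (congrArg Subtype.val h))

theorem denseRange_thetaRep : DenseRange (thetaRep (K := K)) := by
  intro x
  rw [closure_subtype]
  refine closure_mono ?_ x.2
  rintro _ ⟨f, hf, rfl⟩
  exact ⟨thetaRep ⟨f, hf⟩, ⟨_, rfl⟩, rfl⟩

theorem thetaCStar_le_heckeCStar : thetaCStar K ≤ heckeCStar (intAffGroup K) := by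
  refine StarSubalgebra.topologicalClosure_mono ?_
  rintro _ ⟨f, -, rfl⟩
  exact ⟨f, rfl⟩

theorem thetaRelations_thetaCStarGen : ThetaRelations (thetaCStarGen (K := K)) :=
  thetaRelations_thetaGen.map (thetaRep (K := K))

variable (K) in
theorem isLocallyFiniteDimensional_thetaAlg : IsLocallyFiniteDimensional (thetaAlg K) := by
  intro f
  obtain ⟨d, hd, hf⟩ := exists_mem_thetaSpan f.2
  have : FiniteDimensional ℂ (thetaSpanAlg d) := finiteDimensional_thetaSpan hd
  let i : thetaSpanAlg d →⋆ₐ[ℂ] thetaAlg K :=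
    StarSubalgebra.inclusion (thetaSpanAlg_le_thetaAlg d)
  exact ⟨i.range, .of_surjective i.rangeRestrict.toAlgHom.toLinearMap
    i.toAlgHom.rangeRestrict_surjective, ⟨f, hf⟩, rfl⟩

instance : IsClosed (thetaCStar K : Set (HeckeL2 (intAffGroup K) →L[ℂ] HeckeL2 (intAffGroup K))) :=
  StarSubalgebra.isClosed_topologicalClosure _

variable {B : Type*} [CStarAlgebra B] {x : KModO K → B}

theorem comp_thetaRep_eq_thetaLift_iff (hx : ThetaRelations x) {φ : thetaCStar K →⋆ₐ[ℂ] B} :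
    φ.comp thetaRep = thetaLift hx ↔ ∀ r, φ (thetaCStarGen r) = x r := by
  refine ⟨fun h r => ?_, fun h => thetaAlg_hom_ext fun r => ?_⟩
  · rw [← thetaRep_thetaGen, ← StarAlgHom.comp_apply, h, thetaLift_thetaGen]
  · rw [StarAlgHom.comp_apply, thetaRep_thetaGen, h, thetaLift_thetaGen]

theorem existsUnique_thetaCStar_hom (hx : ThetaRelations x) :
    ∃! φ : thetaCStar K →⋆ₐ[ℂ] B, ∀ r, φ (thetaCStarGen r) = x r := by
  simp only [← comp_thetaRep_eq_thetaLift_iff hx]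
  exact (isLocallyFiniteDimensional_thetaAlg K).existsUnique_comp_eq thetaRep_injective
    denseRange_thetaRep _

theorem isometry_of_apply_thetaCStarGen {φ : thetaCStar K →⋆ₐ[ℂ] GroupCStar (KModO K)}
    (h : ∀ r, φ (thetaCStarGen r) = GroupCStar.ofGroupAlg (KModO K) (orbitAverage r)) :
    Isometry φ := by
  have hcomp : φ.comp thetaRep = (GroupCStar.ofGroupAlg (KModO K)).comp thetaRestrict :=
    thetaAlg_hom_ext fun r => by
      rw [StarAlgHom.comp_apply, thetaRep_thetaGen, h, StarAlgHom.comp_apply,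
        thetaRestrict_thetaGen]
  refine (isLocallyFiniteDimensional_thetaAlg K).isometry_of_injective_comp denseRange_thetaRep ?_
  rw [hcomp]
  exact GroupCStar.ofGroupAlg_injective.comp thetaRestrict_injective

end HeckeRepresentation

theorem mainTheorem8 (K : Type u) [Field K] [NumberField K] :
    -- (1) `𝔄` is universal for the relations, has the `θ_r` as a linear basis, and is commutative
    (ThetaRelations (thetaGen (K := K)) ∧
      (∀ (B : Type v) [Ring B] [StarRing B] [Algebra ℂ B] [StarModule ℂ B] (x : KModO K → B),
        ThetaRelations x → ∃! φ : thetaAlg K →⋆ₐ[ℂ] B, ∀ r, φ (thetaGen r) = x r) ∧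
      (∃ b : Module.Basis (MulAction.orbitRel.Quotient (𝓞 K)ˣ (KModO K)) ℂ (thetaAlg K),
        ∀ r : KModO K, b (Quotient.mk'' r) = thetaGen r) ∧
      (∀ f g : thetaAlg K, f * g = g * f)) ∧
    -- (2) `𝔄` is the union of the finite-dimensional subalgebras `𝔄(d)`
    ((∀ d : 𝓞 K, d ≠ 0 → FiniteDimensional ℂ (thetaSpan d) ∧
        ∃ S : StarSubalgebra ℂ (HeckeK K), S.toSubalgebra.toSubmodule = thetaSpan d) ∧
      (thetaAlg K : Set (HeckeK K)) = ⋃ d ∈ {d : 𝓞 K | d ≠ 0}, (thetaSpan d : Set (HeckeK K))) ∧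
    -- (3) `𝔄` embeds in the Hecke C*-algebra, and the C*-subalgebra `A_θ` it generates there is
    -- universal for the relations in the category of (unital) C*-algebras
    (Set.InjOn (heckeRep (intAffGroup K)) (thetaAlg K) ∧
      thetaCStar K ≤ heckeCStar (intAffGroup K) ∧
      ThetaRelations (thetaCStarGen (K := K)) ∧
      (∀ (B : Type w) [CStarAlgebra B] (x : KModO K → B),
        ThetaRelations x → ∃! φ : thetaCStar K →⋆ₐ[ℂ] B, ∀ r, φ (thetaCStarGen r) = x r)) ∧
    -- (4) unit-orbit averages embed `𝔄` in `ℂ[K/𝓞]` and `A_θ` in `C*(K/𝓞)`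
    ((∃ φ : thetaAlg K →⋆ₐ[ℂ] AddMonoidAlgebra ℂ (KModO K),
        (∀ r, φ (thetaGen r) = orbitAverage r) ∧ Function.Injective φ ∧
        ∀ φ' : thetaAlg K →⋆ₐ[ℂ] AddMonoidAlgebra ℂ (KModO K),
          (∀ r, φ' (thetaGen r) = orbitAverage r) → φ' = φ) ∧
      (∃ ψ : thetaCStar K →⋆ₐ[ℂ] GroupCStar (KModO K),
        (∀ r, ψ (thetaCStarGen r) = GroupCStar.ofGroupAlg (KModO K) (orbitAverage r)) ∧
        Isometry ψ ∧
        ∀ ψ' : thetaCStar K →⋆ₐ[ℂ] GroupCStar (KModO K),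
          (∀ r, ψ' (thetaCStarGen r) = GroupCStar.ofGroupAlg (KModO K) (orbitAverage r)) →
            ψ' = ψ)) := by
  obtain ⟨ψ, hψ, hψ_unique⟩ := existsUnique_thetaCStar_hom
    (thetaRelations_orbitAverage.map (GroupCStar.ofGroupAlg (KModO K)))
  exact
    ⟨⟨thetaRelations_thetaGen,
      fun _ _ _ _ _ _ hx => existsUnique_thetaAlg_hom hx,
      exists_basis_thetaGen K,
      thetaAlg_mul_comm⟩,
    ⟨fun d hd => ⟨finiteDimensional_thetaSpan hd, thetaSpanAlg d, thetaSpanAlg_toSubmodule d⟩,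
      coe_thetaAlg_eq_iUnion⟩,
    ⟨heckeRep_injective.injOn,
      thetaCStar_le_heckeCStar,
      thetaRelations_thetaCStarGen,
      fun _ _ _ hx => existsUnique_thetaCStar_hom hx⟩,
    ⟨thetaRestrict, thetaRestrict_thetaGen, thetaRestrict_injective,
      fun φ hφ => thetaAlg_hom_ext fun r => by rw [hφ, thetaRestrict_thetaGen]⟩,
    ψ, hψ, isometry_of_apply_thetaCStarGen hψ, hψ_unique⟩
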